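/- **Theorem (Rips–Čech correspondence).** Let $X$ be a geodesic metric space, i.e. a metric space in which any two points $x,y$ are joined by a path of length $d(x,y)$. For $r>0$ let $\mathrm{Rips}(X,r)$ be the simplicial complex with vertex set $X$ whose simplices are the nonempty finite $\sigma\subset X$ with $\operatorname{diam}\sigma<r$, and let $\check{C}\mathrm{ech}(X,r)$ be the one whose simplices are the nonempty finite $\sigma\subset X$ with $\bigcap_{z\in\sigma}B(z,r)\neq\emptyset$ (open balls). A persistence is a family of groups $\{A_r\}_{r>0}$ with bonding homomorphisms $A_p\to A_q$ for $p<q$; for complexes these are induced by inclusion. An isomorphism of persistences is a family of group isomorphisms commuting with the bonding homomorphisms. For $\bullet\in X$ and real $r$ let $\mathcal L(X,r,\pi_1)\le\pi_1(X,\bullet)$ be the subgroup generated by the classes of the loops $\alpha*\beta*\alpha^-$, where $\alpha$ is a path of finite length from $\bullet$ to some point and $\beta$ is a loop of length less than $r$ based at that point. For an abelian group $G$ let $\mathcal L(X,r,G)\le H_1(X;G)$ (singular homology) be the subgroup generated by the classes $g[\beta]$ with $g\in G$ and $\beta$ a loop of length less than $r$. Put $\mathcal L(X,\mathrm{fin},*)=\bigcup_{n\in\mathbb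 N}\mathcal L(X,n,*)$ for $*=\pi_1$ or $*=G$. (Each $\mathcal L(X,r,\pi_1)$ is a normal subgroup of $\mathcal L(X,\mathrm{fin},\pi_1)$.) Then for every basepoint $\bullet\in X$ there are isomorphisms of persistences $$\{\pi_1(\check{C}\mathrm{ech}(X,3r),\bullet)\}_{r>0}\;\cong\;\{\pi_1(\mathrm{Rips}(X,4r),\bullet)\}_{r>0}\;\cong\;\{\mathcal L(X,\mathrm{fin},\pi_1)/\mathcal L(X,12r,\pi_1)\}_{r>0},$$ and for every abelian group $G$ there are isomorphisms of persistences $$\{H_1(\check{C}\mathrm{ech}(X,3r);G)\}_{r>0}\;\cong\;\{H_1(\mathrm{Rips}(X,4r);G)\}_{r>0}\;\cong\;\{\mathcal L(X,\mathrm{fin},G)/\mathcal L(X,12r,G)\}_{r>0},$$ where the bonding homomorphisms of the last persistence in each line are the natural quotient maps. -/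

import Mathlib

open CategoryTheory

universe u

noncomputable section

namespace RipsCech

/-! ### Geodesic spaces -/

/-- The length of a path: the supremum of the lengths of inscribed polygons. -/
def pathLength {X : Type u} [MetricSpace X] {x y : X} (p : Path x y) : ENNReal :=
  eVariationOn (fun t => p t) Set.univ

/-- Any two points are joined by a path whose length is their distance. -/
def IsGeodesicSpace (X : Type u) [MetricSpace X] : Prop :=
  ∀ x y : X, ∃ p : Path x y, pathLength p = edist x y

/-! ### Positive scales, the open Rips complex and the open Čech complex -/

/-- The ordered set of positive real scales, regarded as a category. -/
abbrev Scale : Type := {r : ℝ // 0 < r}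

/-- The functor `r ↦ c * r` on positive scales. -/
def scaleBy (c : ℝ) (hc : 0 < c) : Scale ⥤ Scale :=
  Monotone.functor (f := fun r : Scale => (⟨c * r.1, mul_pos hc r.2⟩ : Scale))
    (fun r s h => Subtype.mk_le_mk.2 (mul_le_mul_of_nonneg_left (show r.1 ≤ s.1 from h) hc.le))

/-- The open Rips complex: finite nonempty sets of diameter less than `r`. -/
def rips (X : Type u) [MetricSpace X] (r : Scale) : AbstractSimplicialComplex X where
  faces := {s | s.Nonempty ∧ Metric.diam (s : Set X) < r.1}
  isRelLowerSet_faces := fun _ hs =>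
    ⟨hs.1, fun _ ht hne => ⟨hne, (Metric.diam_mono (Finset.coe_subset.2 ht)
      (Finset.finite_toSet _).isBounded).trans_lt hs.2⟩⟩
  singleton_mem := fun v => ⟨Finset.singleton_nonempty v, by simpa using r.2⟩

/-- The open Čech complex: finite nonempty sets whose open `r`-balls have a common point. -/
def cech (X : Type u) [MetricSpace X] (r : Scale) : AbstractSimplicialComplex X where
  faces := {s | s.Nonempty ∧ (⋂ z ∈ s, Metric.ball z r.1).Nonempty}
  isRelLowerSet_faces := fun _ hs =>
    ⟨hs.1, fun _ ht hne => ⟨hne, hs.2.mono (Set.biInter_subset_biInter_left ht)⟩⟩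
  singleton_mem := fun v => ⟨Finset.singleton_nonempty v, ⟨v, by simpa using r.2⟩⟩

theorem rips_mono (X : Type u) [MetricSpace X] : Monotone (rips X) :=
  fun _ _ h _ hs => ⟨hs.1, lt_of_lt_of_le hs.2 h⟩

theorem cech_mono (X : Type u) [MetricSpace X] : Monotone (cech X) :=
  fun _ _ h _ hs =>
    ⟨hs.1, hs.2.mono (Set.iInter₂_mono fun _ _ => Metric.ball_subset_ball h)⟩

/-- The Rips filtration; complexes on the vertex set `X` form a category under inclusion. -/
def ripsFiltration (X : Type u) [MetricSpace X] : Scale ⥤ AbstractSimplicialComplex X :=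
  (rips_mono X).functor

/-- The Čech filtration. -/
def cechFiltration (X : Type u) [MetricSpace X] : Scale ⥤ AbstractSimplicialComplex X :=
  (cech_mono X).functor

/-! ### Geometric realization of a simplicial complex and its fundamental group -/

/-- The closed simplex spanned by the finite set `s`, in barycentric coordinates. As a subspace of
`V → ℝ` it is the usual Euclidean simplex. -/
def closedSimplex {V : Type u} (s : Finset V) : Set (V → ℝ) :=
  {f | (∀ v, 0 ≤ f v) ∧ (∀ v, v ∉ s → f v = 0) ∧ ∑ v ∈ s, f v = 1}

/-- The geometric realization of `K`: the union of the closed simplices of its faces. -/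
structure Realization {V : Type u} (K : AbstractSimplicialComplex V) : Type u where
  weight : V → ℝ
  exists_face : ∃ s ∈ K.faces, weight ∈ closedSimplex s

namespace Realization

variable {V : Type u} {K L : AbstractSimplicialComplex V}

/-- The inclusion of the closed simplex of a face. -/
def ofSimplex (K : AbstractSimplicialComplex V) (s : K.faces) (f : closedSimplex s.1) :
    Realization K :=
  ⟨f.1, s.1, s.2, f.2⟩

/-- The weak topology: a set is open iff its trace on each closed simplex is open. -/
instance : TopologicalSpace (Realization K) :=
  ⨆ s : K.faces, TopologicalSpace.coinduced (ofSimplex K s) inferInstance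

/-- The point of the realization given by a vertex. -/
def vertex (K : AbstractSimplicialComplex V) (v : V) : Realization K :=
  ⟨fun w => Set.indicator {v} (fun _ => (1 : ℝ)) w, {v}, K.singleton_mem v, by
    refine ⟨fun w => Set.indicator_nonneg (fun _ _ => zero_le_one) w, fun w hw => ?_, by simp⟩
    simpa using hw⟩

/-- The inclusion of realizations induced by an inclusion of complexes. -/
def inclusion (h : K ≤ L) : C(Realization K, Realization L) where
  toFun x := ⟨x.weight, x.exists_face.imp fun _ hs => ⟨h hs.1, hs.2⟩⟩
  continuous_toFun := by
    refine continuous_iSup_dom.2 fun s => continuous_coinduced_dom.2 ?_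
    exact continuous_iSup_rng (i := (⟨s.1, h s.2⟩ : L.faces)) continuous_coinduced_rng

end Realization

/-- `K ↦ π₁(|K|, x₀)`, with the homomorphisms induced by inclusions. -/
def piOne {V : Type u} (x₀ : V) : AbstractSimplicialComplex V ⥤ GrpCat.{u} where
  obj K := GrpCat.of (FundamentalGroup (Realization K) (Realization.vertex K x₀))
  map {K L} h := GrpCat.ofHom
    (show FundamentalGroup (Realization K) (Realization.vertex K x₀) →*
        FundamentalGroup (Realization L) (Realization.vertex L x₀) from
      FundamentalGroup.map (Realization.inclusion h.le) (Realization.vertex K x₀))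
  map_id K := by
    ext p
    induction p using Path.Homotopic.Quotient.ind with
    | mk a => rfl
  map_comp f g := by
    ext p
    induction p using Path.Homotopic.Quotient.ind with
    | mk a => rfl

/-! ### First homology with coefficients -/

/-- The ordered simplicial set of a complex: its `n`-simplices are the `(n + 1)`-tuples of vertices
that lie in a common face, and faces (degeneracies) omit (repeat) vertices. Its chain complex is the
ordered simplicial chain complex of `K`. -/
def orderedSimplices {V : Type u} : AbstractSimplicialComplex V ⥤ SSet.{u} where
  obj K :=
    { obj := fun n => {a : Fin (n.unop.len + 1) → V // ∃ s ∈ K.faces, ∀ i, a i ∈ s}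
      map := fun f => ↾fun a =>
        ⟨fun i => a.1 (f.unop.toOrderHom i),
          a.2.imp fun _ hs => ⟨hs.1, fun i => hs.2 _⟩⟩ }
  map h :=
    { app := fun _ => ↾fun a => ⟨a.1, a.2.imp fun _ hs => ⟨h.le hs.1, hs.2⟩⟩ }

/-- `K ↦ H₁(K; G)`, simplicial homology with coefficients in the abelian group `G`. -/
def hOne (V : Type u) (G : Type u) [AddCommGroup G] :
    AbstractSimplicialComplex V ⥤ AddCommGrpCat.{u} :=
  orderedSimplices ⋙ SSet.homologyFunctor (AddCommGrpCat.of G) 1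

/-- `H₁(X; G)`, singular homology with coefficients in `G`. -/
abbrev singularHOne (X : Type u) [TopologicalSpace X] (G : Type u) [AddCommGroup G] :
    AddCommGrpCat.{u} :=
  (TopCat.toSSet.obj (TopCat.of X)).homology (AddCommGrpCat.of G) 1

/-- A path, viewed as a singular 1-simplex. -/
def pathSimplex {X : Type u} [TopologicalSpace X] {x y : X} (p : Path x y) :
    (TopCat.toSSet.obj (TopCat.of X)).Edge
      (TopCat.toSSetObj₀Equiv.symm x) (TopCat.toSSetObj₀Equiv.symm y) :=
  TopCat.toSSetObjEdgeEquiv.symm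
    ((TopCat.pathEquiv (X := TopCat.of X) (x := x) (y := y)).symm p)

theorem ι_loop_d {X : Type u} [TopologicalSpace X] (G : Type u) [AddCommGroup G] {y : X}
    (p : Path y y) :
    (TopCat.toSSet.obj (TopCat.of X)).ιChainComplex (R := AddCommGrpCat.of G)
      (pathSimplex p).edge ≫
        ((TopCat.toSSet.obj (TopCat.of X)).chainComplex (AddCommGrpCat.of G)).d 1 0 = 0 := by
  rw [SSet.ιChainComplex_d, Fin.sum_univ_two, (pathSimplex p).src_eq, (pathSimplex p).tgt_eq]
  simp

/-- `g ↦ g • [p]`: the homology class of the singular cycle `g • p`, for a loop `p`. -/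
def loopClass {X : Type u} [TopologicalSpace X] (G : Type u) [AddCommGroup G] {y : X}
    (p : Path y y) : AddCommGrpCat.of G ⟶ singularHOne X G :=
  HomologicalComplex.liftCycles _
      ((TopCat.toSSet.obj (TopCat.of X)).ιChainComplex (pathSimplex p).edge) 0
      (ChainComplex.next_nat_succ 0) (ι_loop_d G p) ≫
    HomologicalComplex.homologyπ _ 1

/-! ### The groups generated by short loops -/

/-- The class of the lasso `α * β * α⁻¹` in the fundamental group. -/
def lasso {X : Type u} [TopologicalSpace X] {x₀ y : X} (α : Path x₀ y) (β : Path y y) :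
    FundamentalGroup X x₀ :=
  FundamentalGroup.fromPath (Path.Homotopic.Quotient.mk ((α.trans β).trans α.symm))

/-- `L(X, r, π₁)`: generated by the lassos with rectifiable tail and loop of length less than
`r`. -/
def shortPi (X : Type u) [MetricSpace X] (x₀ : X) (r : ℝ) : Subgroup (FundamentalGroup X x₀) :=
  Subgroup.closure {c | ∃ (y : X) (α : Path x₀ y) (β : Path y y),
    pathLength α ≠ ⊤ ∧ pathLength β < ENNReal.ofReal r ∧ c = lasso α β}

/-- `L(X, fin, π₁)`, the union of the increasing sequence of the `L(X, n, π₁)`. -/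
def finPi (X : Type u) [MetricSpace X] (x₀ : X) : Subgroup (FundamentalGroup X x₀) :=
  ⨆ n : ℕ, shortPi X x₀ n

/-- `L(X, r, G)`: generated by the classes `g • [β]` with `β` a loop of length less than `r`. -/
def shortH (X : Type u) [MetricSpace X] (G : Type u) [AddCommGroup G] (r : ℝ) :
    AddSubgroup (singularHOne X G) :=
  AddSubgroup.closure {c | ∃ (y : X) (β : Path y y) (g : G),
    pathLength β < ENNReal.ofReal r ∧ c = (loopClass G β).hom g}

/-- `L(X, fin, G)`, the union of the increasing sequence of the `L(X, n, G)`. -/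
def finH (X : Type u) [MetricSpace X] (G : Type u) [AddCommGroup G] :
    AddSubgroup (singularHOne X G) :=
  ⨆ n : ℕ, shortH X G n

theorem shortPi_mono (X : Type u) [MetricSpace X] (x₀ : X) : Monotone (shortPi X x₀) := by
  intro r s h
  refine Subgroup.closure_mono ?_
  rintro c ⟨y, α, β, hα, hβ, rfl⟩
  exact ⟨y, α, β, hα, hβ.trans_le (ENNReal.ofReal_le_ofReal h), rfl⟩

theorem shortH_mono (X : Type u) [MetricSpace X] (G : Type u) [AddCommGroup G] :
    Monotone (shortH X G) := by
  intro r s h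
  refine AddSubgroup.closure_mono ?_
  rintro c ⟨y, β, g, hβ, rfl⟩
  exact ⟨y, β, g, hβ.trans_le (ENNReal.ofReal_le_ofReal h), rfl⟩

/-! ### The quotient persistences -/

theorem pathLength_symm {X : Type u} [MetricSpace X] {x y : X} (p : Path x y) :
    pathLength p.symm ≤ pathLength p :=
  eVariationOn.comp_le_of_antitoneOn (fun t => p t) unitInterval.symm
    (fun _ _ _ _ h => unitInterval.symm_le_symm.2 h) (Set.mapsTo_univ _ _)

theorem pathLength_trans_ne_top {X : Type u} [MetricSpace X] {x y z : X} {p : Path x y}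
    {q : Path y z} (hp : pathLength p ≠ ⊤) (hq : pathLength q ≠ ⊤) :
    pathLength (p.trans q) ≠ ⊤ := by
  let h : unitInterval := ⟨1 / 2, by norm_num, by norm_num⟩
  have hl : eVariationOn (fun t => (p.trans q) t) (Set.Iic h) ≤ pathLength p := by
    have : Set.EqOn (fun t => (p.trans q) t)
        ((fun t => p t) ∘ fun t : unitInterval => Set.projIcc 0 1 zero_le_one (2 * (t : ℝ)))
        (Set.Iic h) := by
      intro t ht
      have ht' : (t : ℝ) ≤ 1 / 2 := ht
      simp only [Path.trans_apply, dif_pos ht', Function.comp]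
      congr 1
      exact (Set.projIcc_of_mem zero_le_one _).symm
    rw [eVariationOn.eq_of_eqOn this]
    exact eVariationOn.comp_le_of_monotoneOn _ _
      (fun a _ b _ hab => Set.monotone_projIcc _ (by
        have : (a : ℝ) ≤ b := hab
        linarith)) (Set.mapsTo_univ _ _)
  have hr : eVariationOn (fun t => (p.trans q) t) (Set.Ici h) ≤ pathLength q := by
    have : Set.EqOn (fun t => (p.trans q) t)
        ((fun t => q t) ∘ fun t : unitInterval => Set.projIcc 0 1 zero_le_one (2 * (t : ℝ) - 1))
        (Set.Ici h) := by
      intro t ht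
      have ht' : 1 / 2 ≤ (t : ℝ) := ht
      simp only [Function.comp]
      rcases ht'.eq_or_lt with he | hlt
      · have : t = h := Subtype.ext he.symm
        subst this
        simp [h, Path.trans_apply]
      · simp only [Path.trans_apply, dif_neg (not_le.2 hlt)]
        congr 1
        exact (Set.projIcc_of_mem zero_le_one _).symm
    rw [eVariationOn.eq_of_eqOn this]
    exact eVariationOn.comp_le_of_monotoneOn _ _
      (fun a _ b _ hab => Set.monotone_projIcc _ (by
        have : (a : ℝ) ≤ b := hab
        linarith)) (Set.mapsTo_univ _ _)
  rw [pathLength, ← Set.Iic_union_Ici (a := h), eVariationOn.union _ isGreatest_Iic isLeast_Ici]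
  exact ENNReal.add_ne_top.2 ⟨ne_top_of_le_ne_top hp hl, ne_top_of_le_ne_top hq hr⟩

/-- The classes of rectifiable loops. -/
def rectifiablePi (X : Type u) [MetricSpace X] (x₀ : X) : Subgroup (FundamentalGroup X x₀) where
  carrier := {c | ∃ p : Path x₀ x₀, pathLength p ≠ ⊤ ∧
    c = FundamentalGroup.fromPath (Path.Homotopic.Quotient.mk p)}
  one_mem' := by
    refine ⟨Path.refl x₀, ?_, rfl⟩
    simp [pathLength, eVariationOn]
  mul_mem' := by
    rintro _ _ ⟨p, hp, rfl⟩ ⟨q, hq, rfl⟩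
    exact ⟨q.trans p, pathLength_trans_ne_top hq hp, rfl⟩
  inv_mem' := by
    rintro _ ⟨p, hp, rfl⟩
    exact ⟨p.symm, ne_top_of_le_ne_top hp (pathLength_symm p), rfl⟩

theorem finPi_le_rectifiablePi (X : Type u) [MetricSpace X] (x₀ : X) :
    finPi X x₀ ≤ rectifiablePi X x₀ := by
  refine iSup_le fun n => (Subgroup.closure_le _).2 ?_
  rintro _ ⟨y, α, β, hα, hβ, rfl⟩
  exact ⟨(α.trans β).trans α.symm, pathLength_trans_ne_top
    (pathLength_trans_ne_top hα hβ.ne_top) (ne_top_of_le_ne_top hα (pathLength_symm α)), rfl⟩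

theorem rectifiablePi_le_normalizer (X : Type u) [MetricSpace X] (x₀ : X) (r : ℝ) :
    rectifiablePi X x₀ ≤ Subgroup.normalizer (shortPi X x₀ r : Set (FundamentalGroup X x₀)) := by
  refine Subgroup.le_normalizer_closure_iff.2 ?_
  rintro _ ⟨p, hp, rfl⟩ _ ⟨y, α, β, hα, hβ, rfl⟩
  refine Subgroup.subset_closure ⟨y, p.symm.trans α, β,
    pathLength_trans_ne_top (ne_top_of_le_ne_top hp (pathLength_symm p)) hα, hβ, ?_⟩
  simp only [lasso, Path.trans_symm, Path.symm_symm, FundamentalGroup.mul_def,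
    FundamentalGroup.inv_def, Path.Homotopic.Quotient.mk_trans, Path.Homotopic.Quotient.mk_symm,
    Path.Homotopic.Quotient.trans_assoc]

instance shortPi_normal (X : Type u) [MetricSpace X] (x₀ : X) (r : ℝ) :
    ((shortPi X x₀ r).subgroupOf (finPi X x₀)).Normal :=
  ⟨fun k hk g => Subgroup.le_normalizer_iff.1
    ((finPi_le_rectifiablePi X x₀).trans (rectifiablePi_le_normalizer X x₀ r)) g.1 g.2 k.1 hk⟩

/-- `r ↦ A / N r` with the quotient maps, for an increasing family of normal subgroups. -/
def quotientFunctor {A : Type u} [Group A] (N : Scale → Subgroup A) [∀ r, (N r).Normal]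
    (hN : Monotone N) : Scale ⥤ GrpCat.{u} where
  obj r := GrpCat.of (A ⧸ N r)
  map {r s} h := GrpCat.ofHom (QuotientGroup.map (N r) (N s) (MonoidHom.id A) (hN h.le))
  map_id r := by
    ext c
    rfl
  map_comp f g := by
    ext c
    rfl

/-- `r ↦ A / N r` with the quotient maps, for an increasing family of subgroups of an abelian
group. -/
def quotientAddFunctor {A : Type u} [AddCommGroup A] (N : Scale → AddSubgroup A)
    (hN : Monotone N) : Scale ⥤ AddCommGrpCat.{u} where
  obj r := AddCommGrpCat.of (A ⧸ N r)
  map {r s} h :=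
    AddCommGrpCat.ofHom (QuotientAddGroup.map (N r) (N s) (AddMonoidHom.id A) (hN h.le))
  map_id r := by
    ext c
    rfl
  map_comp f g := by
    ext c
    rfl

/-- The persistence `r ↦ L(X, fin, π₁) / L(X, r, π₁)`. -/
def quotientPi (X : Type u) [MetricSpace X] (x₀ : X) : Scale ⥤ GrpCat.{u} :=
  quotientFunctor (fun r => (shortPi X x₀ r.1).subgroupOf (finPi X x₀))
    (fun _ _ h _ hc => shortPi_mono X x₀ h hc)

/-- The persistence `r ↦ L(X, fin, G) / L(X, r, G)`. -/
def quotientH (X : Type u) [MetricSpace X] (G : Type u) [AddCommGroup G] :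
    Scale ⥤ AddCommGrpCat.{u} :=
  quotientAddFunctor (fun r => (shortH X G r.1).addSubgroupOf (finH X G))
    (fun _ _ h _ hc => shortH_mono X G h hc)

end RipsCech

end

open RipsCech

/-! The Čech complex at scale `s` and the Rips complex at scale `s` kill the loops of `X` shorter
than `L`, where `L = 4 * s` and `L = 3 * s` respectively; the scales `3 * r` and `4 * r` thus share
the threshold `12 * r`. A loop shorter than `4 * s` splits into two arcs, each within `s` of its
midpoint; a loop shorter than `3 * s` splits into three arcs of diameter below `s`. Conversely, the
boundary of a 2-simplex of either complex, drawn in `X` with geodesics, is a product of lassos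
around geodesic triangles of perimeter less than `L`. `IsTight` isolates the common properties.
Every tight complex is then compared with the quotient by loops shorter than `L`, and Rips and Čech
are compared through that quotient.

Both directions of the comparison are holonomies. An edge cocycle `e v w` on `K` defines a covering
with discrete fibre over the realization, by its open stars, and over `X`, by balls of radius `ρ`,
since any three balls with a common point have centres spanning a simplex. Two cocycles matter:
`geodClass`, the classes of geodesics modulo short loops, and the edge cocycle with values in the
fundamental group of the realization. The first, transported around loops of the realization, gives
`piHol`. The second, transported around loops of `X`, kills short loops (`hol_short_loop`) and gives
the inverse. On its own space each cocycle is tautological: its holonomy along a path is the class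
of that path (`hol_eq_class`, `hol_geodClass`, the latter for rectifiable paths). Each comparison
map carries one cocycle to the other up to gauge, so by `hol_gauge` both composites are identities.

For `H₁` the same argument runs with values in groups of homomorphisms from `G`, the universal
cocycle being the class of an edge in the 1-chains modulo boundaries. There the composite is the
identity only up to a term factoring through the boundary; that term vanishes on homology, which
gives injectivity. Surjectivity follows by lifting each rectifiable loop to the holonomy of the
universal cocycle along it, which is a cycle. -/

namespace RipsCech

/-! ### Holonomy of coverings glued from cocycles. -/

open unitInterval Topology

/-! ### Induction along paths -/

/-- A transitive relation on the unit interval that holds locally holds between the ends. -/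
theorem unitInterval_rel_of_local {Q : I → I → Prop}
    (htrans : ∀ a b c, a ≤ b → b ≤ c → Q a b → Q b c → Q a c)
    (hloc : ∀ t, ∃ N ∈ 𝓝 t, ∀ a ∈ N, ∀ b ∈ N, a ≤ b → Q a b) : Q 0 1 := by
  have hloc' : ∀ t, ∃ N, IsOpen N ∧ t ∈ N ∧ ∀ a ∈ N, ∀ b ∈ N, a ≤ b → Q a b := by
    intro t
    obtain ⟨N, hN, h⟩ := hloc t
    obtain ⟨O, hO, hOo, ht⟩ := mem_nhds_iff.1 hN
    exact ⟨O, hOo, ht, fun a ha b hb => h a (hO ha) b (hO hb)⟩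
  choose N hNo ht hQ using hloc'
  obtain ⟨t, t0, tm, ⟨n, hn⟩, hsub⟩ := exists_monotone_Icc_subset_open_cover_unitInterval
    hNo (fun x _ => Set.mem_iUnion.2 ⟨x, ht x⟩)
  have hstep : ∀ k, Q (t k) (t (k + 1)) := by
    intro k
    obtain ⟨i, hi⟩ := hsub k
    have hk := tm (Nat.le_succ k)
    exact hQ i _ (hi (Set.left_mem_Icc.2 hk)) _ (hi (Set.right_mem_Icc.2 hk)) hk
  have hall : ∀ k, Q (t 0) (t k) := by
    intro k
    induction k with
    | zero => exact hQ (t 0) _ (ht _) _ (ht _) le_rfl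
    | succ k ih => exact htrans _ _ _ (tm (Nat.zero_le k)) (tm (Nat.le_succ k)) ih (hstep k)
  have := hall n
  rwa [t0, hn n le_rfl] at this

theorem subpath_class_trans {Y : Type*} [TopologicalSpace Y] {y z : Y} (γ : Path y z)
    (a b c : I) : (Path.Homotopic.Quotient.mk (γ.subpath a b)).trans
      (Path.Homotopic.Quotient.mk (γ.subpath b c)) =
        Path.Homotopic.Quotient.mk (γ.subpath a c) :=
  Path.Homotopic.Quotient.eq.2 ⟨Path.Homotopy.subpathTransSubpath γ a b c⟩

theorem quotient_map_trans {Y Z : Type*} [TopologicalSpace Y] [TopologicalSpace Z] {x y z : Y}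
    (γ : Path.Homotopic.Quotient x y) (δ : Path.Homotopic.Quotient y z) (f : C(Y, Z)) :
    (γ.trans δ).map f = (γ.map f).trans (δ.map f) := by
  rcases γ with ⟨p⟩
  rcases δ with ⟨q⟩
  exact congrArg Path.Homotopic.Quotient.mk (p.map_trans q f.continuous)

theorem quotient_refl_symm {Y : Type*} [TopologicalSpace Y] (y : Y) :
    (Path.Homotopic.Quotient.refl y).symm = Path.Homotopic.Quotient.refl y := by
  rw [← Path.Homotopic.Quotient.refl_trans (Path.Homotopic.Quotient.refl y).symm,
    Path.Homotopic.Quotient.trans_symm]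

/-- A full subpath of `γ` runs from `γ 0` to `γ 1`, which equal the prescribed ends only
propositionally; this removes the resulting cast. -/
theorem of_cast_class {Y : Type*} [TopologicalSpace Y]
    {P : ∀ {y z : Y}, Path.Homotopic.Quotient y z → Prop} {y z y' z' : Y}
    (γ : Path.Homotopic.Quotient y z) (hy : y' = y) (hz : z' = z) (h : P (γ.cast hy hz)) :
    P γ := by
  subst hy hz
  simpa using h

/-- To prove a statement about all paths, it suffices to prove it for the paths in the members of
an open cover, and to show that it is preserved by concatenation. -/
theorem cover_induction {Y V : Type*} [TopologicalSpace Y] {U : V → Set Y}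
    (hU : ∀ v, IsOpen (U v)) (hcov : ∀ y, ∃ v, y ∈ U v)
    {P : ∀ {y z : Y}, Path.Homotopic.Quotient y z → Prop}
    (base : ∀ (v : V) {y z : Y} (γ : Path y z), Set.range γ ⊆ U v →
      P (Path.Homotopic.Quotient.mk γ))
    (trans : ∀ {x y z : Y} (γ : Path.Homotopic.Quotient x y) (δ : Path.Homotopic.Quotient y z),
      P γ → P δ → P (γ.trans δ))
    {y z : Y} (γ : Path.Homotopic.Quotient y z) : P γ := by
  induction γ using Path.Homotopic.Quotient.ind with
  | mk γ =>
    have := unitInterval_rel_of_local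
      (Q := fun a b => P (Path.Homotopic.Quotient.mk (γ.subpath a b)))
      (fun a b c _ _ h1 h2 => by
        rw [← subpath_class_trans γ a b c]
        exact trans _ _ h1 h2)
      (fun t => by
        obtain ⟨v, hv⟩ := hcov (γ t)
        obtain ⟨O, hO, hconv, ht, hOv⟩ : ∃ O : Set I, O ∈ 𝓝 t ∧ O.OrdConnected ∧ t ∈ O ∧
            O ⊆ γ ⁻¹' U v := by
          obtain ⟨a, b, _, h1, h2⟩ := exists_Icc_mem_subset_of_mem_nhds
            (γ.continuous.continuousAt.preimage_mem_nhds ((hU v).mem_nhds hv))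
          exact ⟨Set.Icc a b, h1, Set.ordConnected_Icc, mem_of_mem_nhds h1, h2⟩
        refine ⟨O, hO, fun a ha b hb hab => base v _ ?_⟩
        rw [Path.range_subpath_of_le _ _ _ hab]
        exact Set.image_subset_iff.2 ((hconv.out ha hb).trans hOv))
    rw [Path.subpath_zero_one] at this
    exact of_cast_class _ γ.source γ.target this

/-! ### Holonomy of a locally constant cocycle -/

/-- A locally constant `H`-valued cocycle on an open cover. -/
structure CoverCocycle (V Y H : Type*) [TopologicalSpace Y] [Group H] where
  U : V → Set Y
  isOpen : ∀ v, IsOpen (U v)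
  cover : ∀ y, ∃ v, y ∈ U v
  e : V → V → H
  cocycle : ∀ u v w y, y ∈ U u → y ∈ U v → y ∈ U w → e v w * e u v = e u w

namespace CoverCocycle

variable {V Y H : Type*} [TopologicalSpace Y] [Group H]

section

variable (c : CoverCocycle V Y H)

theorem e_self {v : V} {y : Y} (h : y ∈ c.U v) : c.e v v = 1 := by
  simpa using c.cocycle v v v y h h h

theorem e_mul_e_symm {v w : V} {y : Y} (hv : y ∈ c.U v) (hw : y ∈ c.U w) :
    c.e w v * c.e v w = 1 := by
  rw [c.cocycle v w v y hv hw hv, c.e_self hv]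

/-- The bundle with discrete fibre `H` glued from the cocycle. -/
@[simps]
noncomputable def core [TopologicalSpace H] [DiscreteTopology H] : FiberBundleCore V Y H where
  baseSet := c.U
  isOpen_baseSet := c.isOpen
  indexAt y := (c.cover y).choose
  mem_baseSet_at y := (c.cover y).choose_spec
  coordChange u v _ h := c.e u v * h
  coordChange_self u y hy h := by simp [c.e_self hy]
  continuousOn_coordChange u v := by
    refine Continuous.continuousOn ?_
    exact (continuous_of_discreteTopology (f := fun h : H => c.e u v * h)).comp continuous_snd
  coordChange_comp u v w y hy h := by
    rw [← mul_assoc, c.cocycle u v w y hy.1.1 hy.1.2 hy.2]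

/-- Holonomy is the monodromy of the covering glued from copies of `H` by left multiplication with
`e`. Only the two rules stated here, for a path in one chart and for a concatenation, are used
afterwards. -/
theorem exists_holonomy : ∃ T : ∀ {y z : Y}, V → V → Path.Homotopic.Quotient y z → H,
    (∀ (u v w : V) {y z : Y} (γ : Path y z), Set.range γ ⊆ c.U u → y ∈ c.U v → z ∈ c.U w →
      T v w (Path.Homotopic.Quotient.mk γ) = c.e u w * c.e v u) ∧
    (∀ (u v w : V) {x y z : Y} (γ : Path.Homotopic.Quotient x y)
      (δ : Path.Homotopic.Quotient y z), y ∈ c.U v →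
        T u w (γ.trans δ) = T v w δ * T u v γ) := by
  let _ : TopologicalSpace H := ⊥
  have : DiscreteTopology H := ⟨rfl⟩
  let Z := c.core
  have cov : IsCoveringMap Z.proj := FiberBundle.isCoveringMap (F := H) (E := Z.Fiber)
  let m : ∀ {y z : Y}, Path.Homotopic.Quotient y z → H → H := fun {y z} γ h =>
    (cov.monodromy γ ⟨⟨y, h⟩, rfl⟩).1.2
  have m_eq : ∀ {y z : Y} (γ : Path.Homotopic.Quotient y z) (h : H),
      cov.monodromy γ ⟨⟨y, h⟩, rfl⟩ = ⟨⟨z, m γ h⟩, rfl⟩ := by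
    intro y z γ h
    have key : ∀ q : Z.proj ⁻¹' {z}, q = ⟨⟨z, q.1.2⟩, rfl⟩ := by
      rintro ⟨⟨a, b⟩, rfl⟩
      rfl
    exact key _
  have m_trans : ∀ {x y z : Y} (γ : Path.Homotopic.Quotient x y)
      (δ : Path.Homotopic.Quotient y z) (h : H), m (γ.trans δ) h = m δ (m γ h) := by
    intro x y z γ δ h
    change (cov.monodromy (γ.trans δ) ⟨⟨x, h⟩, rfl⟩).1.2 = _
    rw [cov.monodromy_trans_apply, m_eq]
  have idx : ∀ y, y ∈ c.U (Z.indexAt y) := Z.mem_baseSet_at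
  have m_base : ∀ (u : V) {y z : Y} (γ : Path y z), Set.range γ ⊆ c.U u → ∀ h,
      m (Path.Homotopic.Quotient.mk γ) h =
        c.e u (Z.indexAt z) * (c.e (Z.indexAt y) u * h) := by
    intro u y z γ hγ h
    have hmem : ∀ t, γ t ∈ c.U u := fun t => hγ ⟨t, rfl⟩
    -- The lift of a path inside one chart is constant in the fibre coordinate of that chart.
    let Γ : C(I, Z.TotalSpace) :=
      ⟨fun t => (Z.localTriv u).toOpenPartialHomeomorph.symm (γ t, c.e (Z.indexAt y) u * h), by
        refine (Z.localTriv u).toOpenPartialHomeomorph.symm.continuousOn.comp_continuous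
          (by fun_prop) fun t => ?_
        exact (Z.mem_localTriv_target u _).2 (hmem t)⟩
    have hΓ : ∀ t, Γ t = ⟨γ t, c.e u (Z.indexAt (γ t)) * (c.e (Z.indexAt y) u * h)⟩ :=
      fun t => rfl
    have h0 : Γ 0 = ⟨y, h⟩ := by
      have : ∀ y', y' = y → y' ∈ c.U u →
          (⟨y', c.e u (Z.indexAt y') * (c.e (Z.indexAt y) u * h)⟩ : Z.TotalSpace) = ⟨y, h⟩ := by
        rintro _ rfl hy
        rw [← mul_assoc, c.e_mul_e_symm (idx _) hy, one_mul]
      exact this _ γ.source (hmem 0)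
    have hlift := (cov.eq_liftPath_iff' (γ := (γ : C(I, Y))) (e := (⟨y, h⟩ : Z.TotalSpace))
      (γ_0 := γ.source) (Γ := Γ)).2 ⟨by ext t; rfl, h0⟩
    have h1 : (cov.monodromy (Path.Homotopic.Quotient.mk γ) ⟨⟨y, h⟩, rfl⟩).1 = Γ 1 := by
      rw [hlift]; rfl
    have h2 : (⟨z, m (Path.Homotopic.Quotient.mk γ) h⟩ : Z.TotalSpace) = Γ 1 := by
      rw [← h1, m_eq]
    rw [hΓ] at h2
    have : ∀ z' k, z' = z → (⟨z, k⟩ : Z.TotalSpace) =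
        ⟨z', c.e u (Z.indexAt z') * (c.e (Z.indexAt y) u * h)⟩ →
        k = c.e u (Z.indexAt z) * (c.e (Z.indexAt y) u * h) := by
      rintro _ k rfl hk
      cases hk
      rfl
    exact this _ _ γ.target h2
  -- Transition maps are left multiplications, so transport commutes with right multiplication and
  -- is determined by its value at 1.
  have m_mul : ∀ {y z : Y} (γ : Path.Homotopic.Quotient y z), ∀ h, m γ h = m γ 1 * h := by
    intro y z γ
    refine cover_induction (P := fun γ => ∀ h, m γ h = m γ 1 * h) c.isOpen c.cover ?_ ?_ γ
    · intro v y z γ hγ h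
      rw [m_base v γ hγ, m_base v γ hγ]
      group
    · intro x y z γ δ hγ hδ h
      rw [m_trans, m_trans, hγ, hδ, hδ (m γ 1), mul_assoc]
  -- Transport is computed in the preferred charts at `y` and `z`; the outer factors translate it to
  -- the sheets `v` and `w`.
  refine ⟨fun {y z} v w γ => c.e (Z.indexAt z) w * m γ 1 * c.e v (Z.indexAt y), ?_, ?_⟩
  · intro u v w y z γ hγ hv hw
    have hy : y ∈ c.U u := hγ ⟨0, γ.source⟩
    have hz : z ∈ c.U u := hγ ⟨1, γ.target⟩
    simp only [m_base u γ hγ, mul_one]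
    rw [← mul_assoc, c.cocycle u _ w z hz (idx z) hw, mul_assoc, c.cocycle v _ u y hv (idx y) hy]
  · intro u v w x y z γ δ hv
    simp only [m_trans]
    rw [m_mul δ (m γ 1)]
    simp only [mul_assoc]
    rw [← mul_assoc (c.e v _) (c.e _ v), c.e_mul_e_symm (idx y) hv, one_mul]

/-- The holonomy of a path, read off from sheet `v` at the start to sheet `w` at the end. -/
noncomputable def hol {y z : Y} (v w : V) (γ : Path.Homotopic.Quotient y z) : H :=
  c.exists_holonomy.choose v w γ

theorem hol_of_range (u v w : V) {y z : Y} (γ : Path y z) (hγ : Set.range γ ⊆ c.U u)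
    (hy : y ∈ c.U v) (hz : z ∈ c.U w) :
    c.hol v w (Path.Homotopic.Quotient.mk γ) = c.e u w * c.e v u :=
  c.exists_holonomy.choose_spec.1 u v w γ hγ hy hz

theorem hol_trans (u v w : V) {x y z : Y} (γ : Path.Homotopic.Quotient x y)
    (δ : Path.Homotopic.Quotient y z) (hy : y ∈ c.U v) :
    c.hol u w (γ.trans δ) = c.hol v w δ * c.hol u v γ :=
  c.exists_holonomy.choose_spec.2 u v w γ δ hy

theorem hol_refl {v w : V} {y : Y} (hv : y ∈ c.U v) (hw : y ∈ c.U w) :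
    c.hol v w (Path.Homotopic.Quotient.refl y) = c.e v w := by
  rw [← Path.Homotopic.Quotient.mk_refl, c.hol_of_range v v w _ (by simpa using hv) hv hw,
    c.e_self hv, mul_one]

theorem hol_symm {v w : V} {y z : Y} (γ : Path.Homotopic.Quotient y z) (hy : y ∈ c.U v)
    (hz : z ∈ c.U w) : c.hol w v γ.symm = (c.hol v w γ)⁻¹ := by
  rw [eq_inv_iff_mul_eq_one, ← c.hol_trans v w v γ γ.symm hz,
    Path.Homotopic.Quotient.trans_symm, c.hol_refl hy hy, c.e_self hy]

end

/-- Naturality of holonomy under refinements, homomorphisms and changes of gauge. -/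
theorem hol_map {Y' H' : Type*} [TopologicalSpace Y'] [Group H'] (c : CoverCocycle V Y H)
    (c' : CoverCocycle V Y' H') (f : C(Y, Y')) (q : H →* H') (s : V → H')
    (hU : ∀ v y, y ∈ c.U v → f y ∈ c'.U v)
    (he : ∀ v w y, y ∈ c.U v → y ∈ c.U w → q (c.e v w) = s w * c'.e v w * (s v)⁻¹)
    {y z : Y} (γ : Path.Homotopic.Quotient y z) {v w : V} (hy : y ∈ c.U v) (hz : z ∈ c.U w) :
    q (c.hol v w γ) = s w * c'.hol v w (γ.map f) * (s v)⁻¹ := by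
  refine cover_induction (P := fun {y z} γ => ∀ v w : V, y ∈ c.U v → z ∈ c.U w →
    q (c.hol v w γ) = s w * c'.hol v w (γ.map f) * (s v)⁻¹) c.isOpen c.cover ?_ ?_ γ v w hy hz
  · intro u y z γ hγ v w hy hz
    have hyu : y ∈ c.U u := hγ ⟨0, γ.source⟩
    have hzu : z ∈ c.U u := hγ ⟨1, γ.target⟩
    rw [← Path.Homotopic.Quotient.mk_map, c.hol_of_range u v w γ hγ hy hz,
      c'.hol_of_range u v w _ ?_ (hU _ _ hy) (hU _ _ hz), map_mul, he u w z hzu hz,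
      he v u y hy hyu]
    · group
    · rintro _ ⟨t, rfl⟩
      exact hU _ _ (hγ ⟨t, rfl⟩)
  · intro x y z γ δ hγ hδ u w hx hz
    obtain ⟨v, hv⟩ := c.cover y
    rw [c.hol_trans u v w γ δ hv, quotient_map_trans,
      c'.hol_trans u v w _ _ (hU _ _ hv), map_mul, hγ u v hx hv, hδ v w hv hz]
    group

/-- Naturality of holonomy under homomorphisms and changes of gauge. -/
theorem hol_gauge {H' : Type*} [Group H'] (c : CoverCocycle V Y H)
    (c' : CoverCocycle V Y H') (q : H →* H') (s : V → H') (hU : ∀ v y, y ∈ c.U v → y ∈ c'.U v)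
    (he : ∀ v w y, y ∈ c.U v → y ∈ c.U w → q (c.e v w) = s w * c'.e v w * (s v)⁻¹)
    {y z : Y} (γ : Path.Homotopic.Quotient y z) {v w : V} (hy : y ∈ c.U v) (hz : z ∈ c.U w) :
    q (c.hol v w γ) = s w * c'.hol v w γ * (s v)⁻¹ := by
  have h := hol_map c c' (ContinuousMap.id Y) q s hU he γ hy hz
  rcases γ with ⟨p⟩
  exact h

end CoverCocycle
end RipsCech

/-! ### Homotopy classes of paths in a realization. -/

namespace RipsCech

open unitInterval Topology

/-! ### Squares of paths -/

/-- The square is contractible, so the two ways round its boundary are homotopic, and `F` carries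
the homotopy over. -/
theorem class_of_square {Y : Type*} [TopologicalSpace Y] {y z y' z' : Y} (F : C(I × I, Y))
    (b : Path y z) (r : Path z z') (l : Path y y') (t : Path y' z')
    (hb : ∀ s, F (s, 0) = b s) (hr : ∀ s, F (1, s) = r s) (hl : ∀ s, F (0, s) = l s)
    (ht : ∀ s, F (s, 1) = t s) :
    (Path.Homotopic.Quotient.mk b).trans (Path.Homotopic.Quotient.mk r) =
      (Path.Homotopic.Quotient.mk l).trans (Path.Homotopic.Quotient.mk t) := by
  obtain rfl : F (0, 0) = y := (hb 0).trans b.source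
  obtain rfl : F (1, 0) = z := (hb 1).trans b.target
  obtain rfl : F (0, 1) = y' := (hl 1).trans l.target
  obtain rfl : F (1, 1) = z' := (hr 1).trans r.target
  let bI : Path ((0, 0) : I × I) (1, 0) := ⟨⟨fun s => (s, 0), by fun_prop⟩, rfl, rfl⟩
  let rI : Path ((1, 0) : I × I) (1, 1) := ⟨⟨fun s => (1, s), by fun_prop⟩, rfl, rfl⟩
  let lI : Path ((0, 0) : I × I) (0, 1) := ⟨⟨fun s => (0, s), by fun_prop⟩, rfl, rfl⟩
  let tI : Path ((0, 1) : I × I) (1, 1) := ⟨⟨fun s => (s, 1), by fun_prop⟩, rfl, rfl⟩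
  have : ContractibleSpace I :=
    (convex_Icc (0 : ℝ) 1).contractibleSpace ⟨0, by simp⟩
  have h : Path.Homotopic.Quotient.mk (bI.trans rI) =
    Path.Homotopic.Quotient.mk (lI.trans tI) := Subsingleton.elim _ _
  have h' := congrArg (fun γ => Path.Homotopic.Quotient.map γ F) h
  have e1 : bI.map F.continuous = b := Path.ext (funext hb)
  have e2 : rI.map F.continuous = r := Path.ext (funext hr)
  have e3 : lI.map F.continuous = l := Path.ext (funext hl)
  have e4 : tI.map F.continuous = t := Path.ext (funext ht)
  simp only [Path.Homotopic.Quotient.mk_trans, quotient_map_trans] at h'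
  rw [← Path.Homotopic.Quotient.mk_map, ← Path.Homotopic.Quotient.mk_map,
    ← Path.Homotopic.Quotient.mk_map, ← Path.Homotopic.Quotient.mk_map, e1, e2, e3, e4] at h'
  exact h'

/-! ### Stars and segments in a realization -/

/-- The vertices `u`, `v`, `w` lie in a common face. -/
def Spans {V : Type u} (K : AbstractSimplicialComplex V) (u v w : V) : Prop :=
  ∃ s ∈ K.faces, u ∈ s ∧ v ∈ s ∧ w ∈ s

theorem convex_closedSimplex {V : Type u} (s : Finset V) : Convex ℝ (closedSimplex s) := by
  intro f hf g hg a b ha hb hab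
  refine ⟨fun v => ?_, fun v hv => ?_, ?_⟩
  · have := hf.1 v
    have := hg.1 v
    simp only [Pi.add_apply, Pi.smul_apply, smul_eq_mul]
    positivity
  · simp [hf.2.1 v hv, hg.2.1 v hv]
  · simp [Finset.sum_add_distrib, ← Finset.mul_sum, hf.2.2, hg.2.2, hab]

namespace Realization

variable {V : Type u} {K : AbstractSimplicialComplex V}

@[ext]
theorem ext' {x y : Realization K} (h : x.weight = y.weight) : x = y := by
  cases x; cases y; cases h; rfl

theorem continuous_ofSimplex (s : K.faces) : Continuous (ofSimplex K s) :=
  continuous_iSup_rng (i := s) continuous_coinduced_rng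

theorem isOpen_iff {O : Set (Realization K)} :
    IsOpen O ↔ ∀ s : K.faces, IsOpen (ofSimplex K s ⁻¹' O) := by
  rw [isOpen_iSup_iff]
  exact forall_congr' fun s => isOpen_coinduced

/-- The projection onto a realization of the disjoint union of its simplices. -/
def proj (K : AbstractSimplicialComplex V) (x : Σ s : K.faces, closedSimplex s.1) :
    Realization K :=
  ofSimplex K x.1 x.2

/-- Quotient maps stay quotient maps after a product with the locally compact `I`; this is what lets
`continuous_cone` be checked one simplex at a time in the weak topology. -/
theorem isQuotientMap_proj : IsQuotientMap (proj K) := by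
  refine (isQuotientMap_iff _).2 ⟨isCoinducing_iff.2 fun O => ?_, fun x => ?_⟩
  · rw [isOpen_iff, isOpen_sigma_iff]
    rfl
  · obtain ⟨s, hs, hx⟩ := x.exists_face
    exact ⟨⟨⟨s, hs⟩, ⟨x.weight, hx⟩⟩, rfl⟩

/-- The open star of a vertex. -/
def star (K : AbstractSimplicialComplex V) (v : V) : Set (Realization K) :=
  {x | 0 < x.weight v}

theorem isOpen_star (v : V) : IsOpen (star K v) := by
  rw [isOpen_iff]
  intro s
  have : Continuous fun f : closedSimplex s.1 => f.1 v :=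
    (continuous_apply v).comp continuous_subtype_val
  exact this.isOpen_preimage _ isOpen_Ioi

theorem exists_mem_star (x : Realization K) : ∃ v, x ∈ star K v := by
  obtain ⟨s, -, hx⟩ := x.exists_face
  by_contra! h
  have : ∑ v ∈ s, x.weight v ≤ 0 := Finset.sum_nonpos fun v _ => not_lt.1 (h v)
  linarith [hx.2.2]

theorem mem_of_mem_star {x : Realization K} {v : V} {s : Finset V}
    (hs : x.weight ∈ closedSimplex s) (hv : x ∈ star K v) : v ∈ s := by
  by_contra h
  exact (hs.2.1 v h).not_gt hv

/-- A vertex of positive weight belongs to every face carrying the point. Hence a cocycle on `K` is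
a cocycle on the cover by open stars. -/
theorem spans_of_mem_star {x : Realization K} {u v w : V} (hu : x ∈ star K u)
    (hv : x ∈ star K v) (hw : x ∈ star K w) : Spans K u v w := by
  obtain ⟨s, hs, hx⟩ := x.exists_face
  exact ⟨s, hs, mem_of_mem_star hx hu, mem_of_mem_star hx hv, mem_of_mem_star hx hw⟩

theorem vertex_mem_star (v : V) : vertex K v ∈ star K v := by
  simp [star, vertex]

theorem vertex_mem_closedSimplex {s : Finset V} {v : V} (hv : v ∈ s) :
    (vertex K v).weight ∈ closedSimplex s := by
  refine ⟨fun w => ?_, fun w hw => ?_, ?_⟩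
  · change 0 ≤ Set.indicator {v} (fun _ => (1 : ℝ)) w
    exact Set.indicator_apply_nonneg fun _ => zero_le_one
  · change Set.indicator {v} (fun _ => (1 : ℝ)) w = 0
    refine Set.indicator_of_notMem (fun h => hw ?_) _
    rw [Set.mem_singleton_iff.1 h]
    exact hv
  · classical
    simp only [vertex, Set.indicator_apply, Set.mem_singleton_iff]
    rw [Finset.sum_eq_single_of_mem v hv (fun w _ hw => if_neg hw), if_pos rfl]

/-- Two points lie in a common closed simplex. -/
def Near (x y : Realization K) : Prop :=
  ∃ s ∈ K.faces, x.weight ∈ closedSimplex s ∧ y.weight ∈ closedSimplex s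

theorem Near.symm {x y : Realization K} (h : Near x y) : Near y x :=
  h.imp fun _ hs => ⟨hs.1, hs.2.2, hs.2.1⟩

theorem near_vertex {x : Realization K} {v : V} (h : x ∈ star K v) : Near x (vertex K v) := by
  obtain ⟨s, hs, hx⟩ := x.exists_face
  exact ⟨s, hs, hx, vertex_mem_closedSimplex (mem_of_mem_star hx h)⟩

theorem near_vertices {v w : V} (h : Spans K v w w) : Near (vertex K v) (vertex K w) := by
  obtain ⟨s, hs, hv, hw, -⟩ := h
  exact ⟨s, hs, vertex_mem_closedSimplex hv, vertex_mem_closedSimplex hw⟩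

/-- The straight path between two points of a simplex. -/
def linePath {x y : Realization K} (h : Near x y) : Path x y where
  toFun t := ⟨AffineMap.lineMap x.weight y.weight (t : ℝ), h.imp fun s hs =>
    ⟨hs.1, (convex_closedSimplex s).lineMap_mem hs.2.1 hs.2.2 t.2⟩⟩
  continuous_toFun := by
    obtain ⟨s, hs, hx, hy⟩ := h
    have : Continuous fun t : I => (⟨AffineMap.lineMap x.weight y.weight (t : ℝ),
        (convex_closedSimplex s).lineMap_mem hx hy t.2⟩ : closedSimplex s) :=
      Continuous.subtype_mk (AffineMap.lineMap_continuous.comp continuous_subtype_val) _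
    exact (continuous_ofSimplex ⟨s, hs⟩).comp this
  source' := by ext; simp
  target' := by ext; simp

/-- The class of the straight path between two points of a simplex. -/
def line {x y : Realization K} (h : Near x y) : Path.Homotopic.Quotient x y :=
  Path.Homotopic.Quotient.mk (linePath h)

/-- All three segments lie in the closed simplex of `s`, which is convex and therefore simply
connected. -/
theorem line_trans {s : Finset V} (hs : s ∈ K.faces) {x y z : Realization K}
    (hx : x.weight ∈ closedSimplex s) (hy : y.weight ∈ closedSimplex s)
    (hz : z.weight ∈ closedSimplex s) (hxy : Near x y) (hyz : Near y z) (hxz : Near x z) :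
    (line hxy).trans (line hyz) = line hxz := by
  have : ContractibleSpace (closedSimplex s) :=
    (convex_closedSimplex s).contractibleSpace ⟨_, hx⟩
  let p : ∀ {f g : V → ℝ} (hf : f ∈ closedSimplex s) (hg : g ∈ closedSimplex s),
      Path (⟨f, hf⟩ : closedSimplex s) ⟨g, hg⟩ := fun {f g} hf hg =>
    { toFun := fun t => ⟨AffineMap.lineMap f g (t : ℝ),
        (convex_closedSimplex s).lineMap_mem hf hg t.2⟩
      continuous_toFun :=
        Continuous.subtype_mk (AffineMap.lineMap_continuous.comp continuous_subtype_val) _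
      source' := by simp
      target' := by simp }
  have h : Path.Homotopic.Quotient.mk ((p hx hy).trans (p hy hz)) =
    Path.Homotopic.Quotient.mk (p hx hz) := Subsingleton.elim _ _
  have h' := congrArg (fun γ => Path.Homotopic.Quotient.map γ
    (⟨ofSimplex K ⟨s, hs⟩, continuous_ofSimplex _⟩ : C(closedSimplex s, Realization K))) h
  simp only [Path.Homotopic.Quotient.mk_trans, quotient_map_trans] at h'
  exact h'

theorem line_self {x : Realization K} (h : Near x x) :
    line h = Path.Homotopic.Quotient.refl x := by
  refine congrArg Path.Homotopic.Quotient.mk ?_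
  ext t
  simp [linePath]

theorem line_symm {x y : Realization K} (h : Near x y) : (line h).symm = line h.symm := by
  refine congrArg Path.Homotopic.Quotient.mk ?_
  refine Path.ext (funext fun t => Realization.ext' ?_)
  exact AffineMap.lineMap_apply_one_sub x.weight y.weight (t : ℝ)

/-- Straight contraction of the open star of `v` to `v`. -/
noncomputable def cone (v : V) (p : star K v × I) : Realization K :=
  linePath (near_vertex p.1.2) p.2

/-- The star is a quotient of an open part of the disjoint union of simplices, and on each simplex
the contraction is an affine formula with values in that same simplex. -/
theorem continuous_cone (v : V) : Continuous (cone (K := K) v) := by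
  have hq := isQuotientMap_proj.restrictPreimage_isOpen (isOpen_star (K := K) v)
  refine hq.continuous_lift_prod_left ?_
  have hmem : ∀ (s : K.faces) (f : closedSimplex s.1), 0 < f.1 v → v ∈ s.1 := by
    intro s f hf
    by_contra h
    exact (f.2.2.1 v h).not_gt hf
  classical
  -- Simplices without the vertex `v` do not meet its star; the constant value there only makes `G`
  -- continuous on the whole disjoint union.
  let G : (Σ s : K.faces, closedSimplex s.1) × I → Realization K := fun p =>
    if h : v ∈ p.1.1.1 then ofSimplex K p.1.1
      ⟨AffineMap.lineMap p.1.2.1 (vertex K v).weight (p.2 : ℝ),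
        (convex_closedSimplex p.1.1.1).lineMap_mem p.1.2.2 (vertex_mem_closedSimplex h) p.2.2⟩
    else vertex K v
  have hG : Continuous G := by
    have : Continuous (G ∘ (Homeomorph.sigmaProdDistrib
        (X := fun s : K.faces => closedSimplex s.1) (Y := I)).symm) := by
      refine continuous_sigma fun s => ?_
      by_cases hv : v ∈ s.1
      · have he : Continuous fun p : (closedSimplex s.1) × I => ofSimplex K s
            ⟨AffineMap.lineMap p.1.1 (vertex K v).weight (p.2 : ℝ),
              (convex_closedSimplex s.1).lineMap_mem p.1.2 (vertex_mem_closedSimplex hv) p.2.2⟩ := by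
          refine (continuous_ofSimplex s).comp (Continuous.subtype_mk ?_ _)
          simp only [AffineMap.lineMap_apply_module]
          fun_prop
        convert! he using 2 with p
        exact dif_pos hv
      · convert! continuous_const (y := vertex K v) using 2 with p
        exact dif_neg hv
    simpa [Function.comp_assoc] using this.comp (Homeomorph.continuous Homeomorph.sigmaProdDistrib)
  have : Continuous fun p : (proj K ⁻¹' star K v) × I => G (p.1.1, p.2) := hG.comp (by fun_prop)
  convert! this using 2 with p
  simp only [G]
  rw [dif_pos (hmem p.1.1.1 p.1.1.2 p.1.2)]
  rfl

/-- Coning `γ` off to `v` sweeps out a square whose top side is constant at `v`, so `γ` is homotopic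
to the detour through `v`. -/
theorem class_of_range_subset_star {v : V} {y z : Realization K} (γ : Path y z)
    (h : Set.range γ ⊆ star K v) (hy : Near y (vertex K v)) (hz : Near (vertex K v) z) :
    Path.Homotopic.Quotient.mk γ = (line hy).trans (line hz) := by
  let F : C(I × I, Realization K) :=
    ⟨fun p => cone v (⟨γ p.1, h ⟨p.1, rfl⟩⟩, p.2), (continuous_cone v).comp (by fun_prop)⟩
  have key := class_of_square F γ (linePath hz.symm) (linePath hy) (Path.refl _)
    (fun s => by ext; simp [F, cone, linePath]) (fun s => by ext; simp [F, cone, linePath])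
    (fun s => by ext; simp [F, cone, linePath]) (fun s => by ext; simp [F, cone, linePath])
  rw [Path.Homotopic.Quotient.mk_refl, Path.Homotopic.Quotient.trans_refl] at key
  have h2 : (line hz.symm).trans (line hz) = Path.Homotopic.Quotient.refl z := by
    rw [← line_symm hz, Path.Homotopic.Quotient.symm_trans]
  rw [← show (Path.Homotopic.Quotient.mk γ).trans (line hz.symm) = line hy from key,
    Path.Homotopic.Quotient.trans_assoc, h2, Path.Homotopic.Quotient.trans_refl]

theorem range_linePath {v : V} {x y : Realization K} (hx : x ∈ star K v) (hy : y ∈ star K v)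
    (h : Near x y) : Set.range (linePath h) ⊆ star K v := by
  rintro _ ⟨t, rfl⟩
  have h1 : (0 : ℝ) < x.weight v := hx
  have h2 : (0 : ℝ) < y.weight v := hy
  have h3 := (convex_Ioi (0 : ℝ)).lineMap_mem h1 h2 t.2
  change (0 : ℝ) < (AffineMap.lineMap x.weight y.weight (t : ℝ)) v
  simpa [AffineMap.lineMap_apply] using h3

end Realization
end RipsCech

/-! ### Edge cocycles over the realization. -/

namespace RipsCech

/-! ### Simplicial cocycles and the fundamental group of a realization -/

/-- An `H`-valued 1-cocycle on a simplicial complex. -/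
def IsCocycle {V : Type u} {H : Type*} [Group H] (K : AbstractSimplicialComplex V)
    (e : V → V → H) : Prop :=
  ∀ u v w, Spans K u v w → e v w * e u v = e u w

namespace Realization

variable {V : Type u} {K : AbstractSimplicialComplex V} {H : Type*} [Group H]

/-- The cocycle on the cover of a realization by open stars. -/
@[simps]
def starCocycle {e : V → V → H} (he : IsCocycle K e) : CoverCocycle V (Realization K) H where
  U := star K
  isOpen := isOpen_star
  cover := exists_mem_star
  e := e
  cocycle u v w _ hu hv hw := he u v w (spans_of_mem_star hu hv hw)

/-- An edge with distinct ends lies in neither of their two stars, but its midpoint lies in both;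
each half then stays in one star and the value `e v w` comes from changing sheets at the midpoint.
-/
theorem hol_line {e : V → V → H} (he : IsCocycle K e) {v w : V} (h : Spans K v w w) :
    (starCocycle he).hol v w (line (near_vertices h)) = e v w := by
  set m : Realization K := linePath (near_vertices h) ⟨1 / 2, by norm_num, by norm_num⟩ with hm
  have nonneg : ∀ a b, 0 ≤ (vertex K a).weight b := fun a b => by
    obtain ⟨s, -, hs⟩ := (vertex K a).exists_face
    exact hs.1 b
  have hmw : ∀ a, m.weight a =
      (1 / 2 : ℝ) * (vertex K v).weight a + (1 / 2 : ℝ) * (vertex K w).weight a := by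
    intro a
    change (AffineMap.lineMap (vertex K v).weight (vertex K w).weight (1 / 2 : ℝ)) a = _
    simp only [AffineMap.lineMap_apply_module, Pi.add_apply, Pi.smul_apply, smul_eq_mul]
    ring
  have hv : m ∈ star K v := by
    have h1 : (0 : ℝ) < (vertex K v).weight v := vertex_mem_star v
    have h2 := nonneg w v
    change 0 < m.weight v
    rw [hmw]
    positivity
  have hw : m ∈ star K w := by
    have h1 : (0 : ℝ) < (vertex K w).weight w := vertex_mem_star w
    have h2 := nonneg v w
    change 0 < m.weight w
    rw [hmw]
    positivity
  obtain ⟨s, hs, hvs, hws, -⟩ := id h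
  have hms : m.weight ∈ closedSimplex s :=
    (convex_closedSimplex s).lineMap_mem (vertex_mem_closedSimplex hvs)
      (vertex_mem_closedSimplex hws) (by norm_num)
  have h1 : Near (vertex K v) m := (near_vertex hv).symm
  have h2 : Near m (vertex K w) := near_vertex hw
  rw [← line_trans hs (vertex_mem_closedSimplex hvs) hms (vertex_mem_closedSimplex hws) h1 h2,
    (starCocycle he).hol_trans v v w _ _ hv, line, line,
    (starCocycle he).hol_of_range v v v _ (range_linePath (vertex_mem_star v) hv h1)
      (vertex_mem_star v) hv,
    (starCocycle he).hol_of_range w v w _ (range_linePath hw (vertex_mem_star w) h2)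
      hv (vertex_mem_star w),
    (starCocycle he).e_self (vertex_mem_star v), (starCocycle he).e_self (vertex_mem_star w)]
  simp

open Path.Homotopic.Quotient in
/-- The cocycle given by the edges of `K` recovers every path up to homotopy. -/
theorem hol_eq_class {p : Realization K}
    {e : V → V → FundamentalGroup (Realization K) p} (he : IsCocycle K e)
    (θ : ∀ v, Path.Homotopic.Quotient p (vertex K v))
    (heθ : ∀ v w (h : Spans K v w w), e v w =
      FundamentalGroup.fromPath (((θ v).trans (line (near_vertices h))).trans (θ w).symm))
    {y z : Realization K} (γ : Path.Homotopic.Quotient y z) {v w : V}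
    (hy : y ∈ star K v) (hz : z ∈ star K w) :
    (starCocycle he).hol v w γ = FundamentalGroup.fromPath
      ((((θ v).trans (line (near_vertex hy).symm)).trans γ).trans
        ((line (near_vertex hz)).trans (θ w).symm)) := by
  -- Passing from `v` to `u` through a point of both stars is homotopic to following the edge.
  have tri : ∀ {v u : V} {x : Realization K} (hv : x ∈ star K v) (hu : x ∈ star K u),
      (line (near_vertex hv).symm).trans (line (near_vertex hu)) =
        line (near_vertices (spans_of_mem_star hv hu hu)) := by
    intro v u x hv hu
    obtain ⟨s, hs, hx⟩ := x.exists_face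
    exact line_trans hs (vertex_mem_closedSimplex (mem_of_mem_star hx hv)) hx
      (vertex_mem_closedSimplex (mem_of_mem_star hx hu)) _ _ _
  refine cover_induction (P := fun {y z} γ => ∀ v w (hy : y ∈ star K v) (hz : z ∈ star K w),
    (starCocycle he).hol v w γ = FundamentalGroup.fromPath
      ((((θ v).trans (line (near_vertex hy).symm)).trans γ).trans
        ((line (near_vertex hz)).trans (θ w).symm)))
    isOpen_star exists_mem_star ?_ ?_ γ v w hy hz
  · intro u y z γ hγ v w hy hz
    have hyu : y ∈ star K u := hγ ⟨0, γ.source⟩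
    have hzu : z ∈ star K u := hγ ⟨1, γ.target⟩
    rw [(starCocycle he).hol_of_range u v w γ hγ hy hz, starCocycle_e, starCocycle_e,
      heθ u w (spans_of_mem_star hzu hz hz), heθ v u (spans_of_mem_star hy hyu hyu),
      FundamentalGroup.mul_def,
      class_of_range_subset_star γ hγ (near_vertex hyu) (near_vertex hzu).symm, ← tri hy hyu,
      ← tri hzu hz]
    simp only [trans_assoc]
    rw [← trans_assoc (θ u).symm, symm_trans, refl_trans]
  · intro x y z γ δ hγ hδ v w hx hz
    obtain ⟨u, hu⟩ := exists_mem_star y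
    rw [(starCocycle he).hol_trans v u w γ δ hu, hγ v u hx hu, hδ u w hu hz,
      FundamentalGroup.mul_def]
    simp only [trans_assoc]
    rw [← trans_assoc (θ u).symm, symm_trans, refl_trans,
      ← trans_assoc (line (near_vertex hu)), ← line_symm (near_vertex hu), trans_symm, refl_trans]

end Realization
end RipsCech

/-! ### Rectifiable arcs and the metric input from the two complexes. -/

namespace RipsCech

open unitInterval Topology

/-! ### Lengths of arcs -/

section arcs

variable {X : Type u} [MetricSpace X] {x y z : X}

/-- The length of the arc of `p` between the parameters `a` and `b`. -/
noncomputable def arc (p : Path x y) (a b : I) : ENNReal :=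
  eVariationOn (fun t => p t) (Set.Icc a b)

theorem arc_mono (p : Path x y) {a b a' b' : I} (ha : a' ≤ a) (hb : b ≤ b') :
    arc p a b ≤ arc p a' b' :=
  eVariationOn.mono _ (Set.Icc_subset_Icc ha hb)

theorem arc_add (p : Path x y) {a b c : I} (hab : a ≤ b) (hbc : b ≤ c) :
    arc p a b + arc p b c = arc p a c := by
  simpa [arc] using eVariationOn.Icc_add_Icc (fun t => p t) (s := Set.univ) hab hbc (Set.mem_univ b)

theorem arc_self (p : Path x y) (a : I) : arc p a a = 0 :=
  eVariationOn.subsingleton _ (by simp)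

theorem arc_le_pathLength (p : Path x y) (a b : I) : arc p a b ≤ pathLength p :=
  eVariationOn.mono _ (Set.subset_univ _)

theorem arc_zero_one (p : Path x y) : arc p 0 1 = pathLength p := by
  rw [arc, pathLength]
  congr 1
  exact Set.eq_univ_of_forall fun t => ⟨t.2.1, t.2.2⟩

theorem edist_le_arc (p : Path x y) {a b s t : I} (hs : s ∈ Set.Icc a b) (ht : t ∈ Set.Icc a b) :
    edist (p s) (p t) ≤ arc p a b :=
  eVariationOn.edist_le (fun t => p t) hs ht

theorem arc_ne_top {p : Path x y} (hp : pathLength p ≠ ⊤) (a b : I) : arc p a b ≠ ⊤ :=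
  ne_top_of_le_ne_top hp (arc_le_pathLength p a b)

theorem dist_le_arc {p : Path x y} (hp : pathLength p ≠ ⊤) {a b s t : I}
    (hs : s ∈ Set.Icc a b) (ht : t ∈ Set.Icc a b) : dist (p s) (p t) ≤ (arc p a b).toReal := by
  rw [dist_edist]
  exact ENNReal.toReal_mono (arc_ne_top hp a b) (edist_le_arc p hs ht)

theorem pathLength_subpath_le (p : Path x y) {a b : I} (hab : a ≤ b) :
    pathLength (p.subpath a b) ≤ arc p a b := by
  refine eVariationOn.comp_le_of_monotoneOn (fun t => p t) (Set.Icc.convexComb a b) ?_ ?_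
  · intro s _ t _ hst
    change (Set.Icc.convexComb a b s : ℝ) ≤ Set.Icc.convexComb a b t
    rw [Set.Icc.coe_convexComb, Set.Icc.coe_convexComb]
    have h1 : (a : ℝ) ≤ b := hab
    have h2 : (s : ℝ) ≤ t := hst
    nlinarith
  · intro s _
    exact ⟨Set.Icc.le_convexComb hab s, Set.Icc.convexComb_le hab s⟩

theorem pathLength_symm_eq (p : Path x y) : pathLength p.symm = pathLength p :=
  le_antisymm (pathLength_symm p) (by simpa using pathLength_symm p.symm)

theorem pathLength_refl (x : X) : pathLength (Path.refl x) = 0 := by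
  simp [pathLength, eVariationOn]

theorem pathLength_trans_le (p : Path x y) (q : Path y z) :
    pathLength (p.trans q) ≤ pathLength p + pathLength q := by
  let h : I := ⟨1 / 2, by norm_num, by norm_num⟩
  rw [← arc_zero_one, ← arc_add (p.trans q) (b := h) h.2.1 h.2.2]
  refine add_le_add ?_ ?_
  · have : Set.EqOn (fun t => (p.trans q) t)
        ((fun t => p t) ∘ fun t : I => Set.projIcc 0 1 zero_le_one (2 * (t : ℝ)))
        (Set.Icc 0 h) := by
      intro t ht
      have ht' : (t : ℝ) ≤ 1 / 2 := ht.2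
      simp only [Path.trans_apply, dif_pos ht', Function.comp]
      congr 1
      exact (Set.projIcc_of_mem zero_le_one _).symm
    rw [arc, eVariationOn.eq_of_eqOn this]
    exact eVariationOn.comp_le_of_monotoneOn _ _
      (fun a _ b _ hab => Set.monotone_projIcc _ (by
        have : (a : ℝ) ≤ b := hab
        linarith)) (Set.mapsTo_univ _ _)
  · have : Set.EqOn (fun t => (p.trans q) t)
        ((fun t => q t) ∘ fun t : I => Set.projIcc 0 1 zero_le_one (2 * (t : ℝ) - 1))
        (Set.Icc h 1) := by
      intro t ht
      have ht' : 1 / 2 ≤ (t : ℝ) := ht.1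
      simp only [Function.comp]
      rcases ht'.eq_or_lt with he | hlt
      · have : t = h := Subtype.ext he.symm
        subst this
        simp [h, Path.trans_apply]
      · simp only [Path.trans_apply, dif_neg (not_le.2 hlt)]
        congr 1
        exact (Set.projIcc_of_mem zero_le_one _).symm
    rw [arc, eVariationOn.eq_of_eqOn this]
    exact eVariationOn.comp_le_of_monotoneOn _ _
      (fun a _ b _ hab => Set.monotone_projIcc _ (by
        have : (a : ℝ) ≤ b := hab
        linarith)) (Set.mapsTo_univ _ _)

theorem eventually_arc_lt {p : Path x y} (hp : pathLength p ≠ ⊤) (t : I) {ε : ENNReal}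
    (hε : 0 < ε) : ∀ᶠ s in 𝓝 t, arc p s t < ε ∧ arc p t s < ε := by
  have hb : BoundedVariationOn (fun t => p t) Set.univ := hp
  have hc : Continuous fun t => p t := p.continuous
  have h1 := hb.tendsto_eVariationOn_Icc_zero_left (x := t) hc.continuousWithinAt
  have h2 := hb.tendsto_eVariationOn_Icc_zero_right t hc.continuousWithinAt
  simp only [Set.univ_inter, nhdsWithin_univ] at h1 h2
  exact (h1.eventually_lt_const hε).and (h2.eventually_lt_const hε)

/-- A rectifiable path is locally short. -/
theorem exists_nhds_arc_lt {p : Path x y} (hp : pathLength p ≠ ⊤) (t : I) {ε : ENNReal}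
    (hε : 0 < ε) : ∃ N ∈ 𝓝 t, ∀ a ∈ N, ∀ b ∈ N, arc p a b < ε := by
  refine ⟨_, eventually_arc_lt hp t (ENNReal.half_pos hε.ne'), fun a ha b hb => ?_⟩
  -- Enlarging the arc so that it passes through `t` covers every position of `a` and `b` relative
  -- to `t` at once.
  have key : arc p (min a t) t + arc p t (max b t) < ε := by
    rw [← ENNReal.add_halves ε]
    refine ENNReal.add_lt_add ?_ ?_
    · rcases le_total a t with h | h
      · simpa [h] using ha.1
      · simpa [h, arc_self] using hε.ne'
    · rcases le_total b t with h | h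
      · simpa [h, arc_self] using hε.ne'
      · simpa [h] using hb.2
  rw [arc_add p (min_le_right _ _) (le_max_right _ _)] at key
  exact (arc_mono p (min_le_left _ _) (le_max_left _ _)).trans_lt key

/-- Arc length is additive and small near each parameter. Its continuity is what the intermediate
value theorem needs in `exists_arc_eq`. -/
theorem continuous_arc {p : Path x y} (hp : pathLength p ≠ ⊤) :
    Continuous fun t => (arc p 0 t).toReal := by
  rw [Metric.continuous_iff']
  intro t ε hε
  filter_upwards [eventually_arc_lt hp t (ENNReal.ofReal_pos.2 hε)] with s hs
  have hlt : ∀ a b, arc p a b < ENNReal.ofReal ε → (arc p a b).toReal < ε := fun a b h =>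
    (ENNReal.lt_ofReal_iff_toReal_lt (arc_ne_top hp a b)).1 h
  have hadd : ∀ a b : I, a ≤ b →
      (arc p 0 a).toReal + (arc p a b).toReal = (arc p 0 b).toReal := fun a b h => by
    rw [← ENNReal.toReal_add (arc_ne_top hp _ _) (arc_ne_top hp _ _), arc_add p a.2.1 h]
  rw [Real.dist_eq, abs_lt]
  have n1 : 0 ≤ (arc p s t).toReal := ENNReal.toReal_nonneg
  have n2 : 0 ≤ (arc p t s).toReal := ENNReal.toReal_nonneg
  rcases le_total s t with h | h
  · have := hadd s t h
    have := hlt _ _ hs.1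
    constructor <;> linarith
  · have := hadd t s h
    have := hlt _ _ hs.2
    constructor <;> linarith

/-- A rectifiable arc can be divided at a point with prescribed distance along the arc. -/
theorem exists_arc_eq {p : Path x y} (hp : pathLength p ≠ ⊤) {a b : I} (hab : a ≤ b) {c : ℝ}
    (h0 : 0 ≤ c) (hc : c ≤ (arc p a b).toReal) : ∃ t, a ≤ t ∧ t ≤ b ∧
      (arc p a t).toReal = c ∧ (arc p t b).toReal = (arc p a b).toReal - c := by
  have hadd : ∀ u v w : I, u ≤ v → v ≤ w →
      (arc p u v).toReal + (arc p v w).toReal = (arc p u w).toReal := fun u v w h h' => by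
    rw [← ENNReal.toReal_add (arc_ne_top hp _ _) (arc_ne_top hp _ _), arc_add p h h']
  have h1 := hadd 0 a b a.2.1 hab
  obtain ⟨t, ht, htc⟩ := isPreconnected_Icc.intermediate_value (Set.left_mem_Icc.2 hab)
    (Set.right_mem_Icc.2 hab) (continuous_arc hp).continuousOn
    (show (arc p 0 a).toReal + c ∈ _ from ⟨by linarith, by linarith⟩)
  simp only at htc
  have h2 := hadd 0 a t a.2.1 ht.1
  have h3 := hadd a t b ht.1 ht.2
  exact ⟨t, ht.1, ht.2, by linarith, by linarith⟩

theorem eq_refl_of_pathLength_eq_zero (p : Path x x) (hp : pathLength p = 0) :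
    p = Path.refl x := by
  ext t
  have h := eVariationOn.edist_le (fun t => p t) (Set.mem_univ t) (Set.mem_univ (0 : I))
  change _ ≤ pathLength p at h
  rw [hp] at h
  simpa using h

/-- All points of a geodesic are close to its midpoint. -/
theorem exists_midpoint {p : Path x y} (hp : pathLength p = edist x y) :
    ∃ m, ∀ t, dist (p t) m ≤ dist x y / 2 := by
  have hfin : pathLength p ≠ ⊤ := by rw [hp]; exact edist_ne_top _ _
  have hlen : (arc p 0 1).toReal = dist x y := by rw [arc_zero_one, hp, dist_edist]
  have hd : 0 ≤ dist x y := dist_nonneg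
  obtain ⟨s, h0, h1, hs, hs'⟩ := exists_arc_eq hfin (zero_le_one : (0 : I) ≤ 1)
    (c := dist x y / 2) (by linarith) (by linarith)
  refine ⟨p s, fun t => ?_⟩
  rcases le_total t s with h | h
  · exact (dist_le_arc hfin ⟨t.2.1, h⟩ ⟨s.2.1, le_rfl⟩).trans hs.le
  · refine (dist_le_arc hfin ⟨h, t.2.2⟩ ⟨le_rfl, h1⟩).trans ?_
    linarith

theorem dist_le_of_geodesic {p : Path x y} (hp : pathLength p = edist x y) (s t : I) :
    dist (p s) (p t) ≤ dist x y := by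
  have hfin : pathLength p ≠ ⊤ := by rw [hp]; exact edist_ne_top _ _
  have hlen : (arc p 0 1).toReal = dist x y := by rw [arc_zero_one, hp, dist_edist]
  rw [← hlen]
  exact dist_le_arc hfin ⟨s.2.1, s.2.2⟩ ⟨t.2.1, t.2.2⟩

end arcs

/-! ### Complexes of small simplices -/

/-- Any three points of `S` span a simplex. -/
def Small {V : Type u} (K : AbstractSimplicialComplex V) (S : Set V) : Prop :=
  ∀ a ∈ S, ∀ b ∈ S, ∀ c ∈ S, Spans K a b c

/-- The properties that the open Rips complex `K` at scale `L / 3` and the open Čech complex at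
scale `L / 4` have in common. -/
structure IsTight {X : Type u} [MetricSpace X] (K : AbstractSimplicialComplex X)
    (L ρ : ℝ) : Prop where
  pos : 0 < ρ
  -- In `hol_geodClass`, two geodesics shorter than `ρ` are closed up by a small arc; the slack `L -
  -- 2 * ρ` bounds that arc.
  lt : 2 * ρ < L
  ball : ∀ u, Small K (Metric.ball u ρ)
  nerve : ∀ u v w y, y ∈ Metric.ball u ρ → y ∈ Metric.ball v ρ → y ∈ Metric.ball w ρ →
    Spans K u v w
  -- In the Čech complex at scale `s` the perimeter of `u v w` is only known to be below `6 * s`,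
  -- which exceeds `L = 4 * s`. Coning off to a common point `z` of the balls gives three triangles
  -- with two sides below `s` and one below `2 * s`.
  triangle : ∀ u v w, Spans K u v w → ∃ z, dist z u + dist u v + dist z v < L ∧
    dist z v + dist v w + dist z w < L ∧ dist z u + dist u w + dist z w < L
  geodesic : ∀ v w, Spans K v w w → ∀ p : Path v w, pathLength p = edist v w →
    Small K (Set.range p)
  loop : ∀ (y : X) (β : Path y y), pathLength β < ENNReal.ofReal L → ∃ s t,
    Small K (Set.range (β.subpath 0 s)) ∧ Small K (Set.range (β.subpath s t)) ∧
      Small K (Set.range (β.subpath t 1)) ∧ Spans K (β 0) (β s) (β t)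

section tight

variable {X : Type u} [MetricSpace X]

theorem spans_rips {r : Scale} {u v w : X} (h1 : dist u v < r.1) (h2 : dist v w < r.1)
    (h3 : dist u w < r.1) : Spans (rips X r) u v w := by
  classical
  refine ⟨{u, v, w}, ⟨by simp, ?_⟩, by simp, by simp, by simp⟩
  have hfin : ((({u, v, w} : Finset X) : Set X)).Finite := Finset.finite_toSet _
  have : Metric.diam ((({u, v, w} : Finset X) : Set X)) ≤
      max (dist u v) (max (dist v w) (dist u w)) := by
    refine Metric.diam_le_of_forall_dist_le (le_max_of_le_left dist_nonneg) ?_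
    intro a ha b hb
    simp only [Finset.coe_insert, Finset.coe_singleton, Set.mem_insert_iff,
      Set.mem_singleton_iff] at ha hb
    rcases ha with rfl | rfl | rfl <;> rcases hb with rfl | rfl | rfl <;>
      simp [dist_comm]
  exact this.trans_lt (max_lt h1 (max_lt h2 h3))

theorem dist_lt_of_mem_rips {r : Scale} {s : Finset X} (hs : s ∈ (rips X r).faces) {u v : X}
    (hu : u ∈ s) (hv : v ∈ s) : dist u v < r.1 :=
  (Metric.dist_le_diam_of_mem (Finset.finite_toSet s).isBounded hu hv).trans_lt hs.2

theorem small_rips {r : Scale} {S : Set X} (h : ∀ a ∈ S, ∀ b ∈ S, dist a b < r.1) :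
    Small (rips X r) S :=
  fun a ha b hb c hc => spans_rips (h a ha b hb) (h b hb c hc) (h a ha c hc)

/-- A loop shorter than `3 * r` is cut into three arcs shorter than `r`, and the diameter of an arc
is at most its length. Perimeters are already below `3 * r`, so `z = u` serves for the triangles. -/
theorem isTight_rips (r : Scale) : IsTight (rips X r) (3 * r.1) (r.1 / 2) := by
  have hr := r.2
  refine ⟨by linarith, by linarith, fun u => small_rips ?_, ?_, ?_, ?_, ?_⟩
  · intro a ha b hb
    rw [Metric.mem_ball] at ha hb
    have := dist_triangle_right a b u
    linarith
  · intro u v w y hu hv hw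
    rw [Metric.mem_ball] at hu hv hw
    have := dist_triangle_left u v y
    have := dist_triangle_left v w y
    have := dist_triangle_left u w y
    exact spans_rips (by linarith) (by linarith) (by linarith)
  · rintro u v w ⟨s, hs, hu, hv, hw⟩
    have := dist_lt_of_mem_rips hs hu hv
    have := dist_lt_of_mem_rips hs hv hw
    have := dist_lt_of_mem_rips hs hu hw
    exact ⟨u, by rw [dist_self]; linarith, by linarith, by rw [dist_self]; linarith⟩
  · rintro v w ⟨s, hs, hv, hw, -⟩ p hp
    refine small_rips ?_
    rintro _ ⟨a, rfl⟩ _ ⟨b, rfl⟩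
    exact (dist_le_of_geodesic hp a b).trans_lt (dist_lt_of_mem_rips hs hv hw)
  · intro y β hβ
    have hfin := hβ.ne_top
    set ℓ := (arc β 0 1).toReal with hℓ
    have hℓ3 : ℓ < 3 * r.1 := by
      rw [hℓ, arc_zero_one]
      exact (ENNReal.lt_ofReal_iff_toReal_lt hfin).1 hβ
    have hℓ0 : 0 ≤ ℓ := ENNReal.toReal_nonneg
    obtain ⟨s, h0s, hs1, hs, hs'⟩ := exists_arc_eq hfin (zero_le_one : (0 : I) ≤ 1)
      (c := ℓ / 3) (by linarith) (by linarith)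
    obtain ⟨t, hst, ht1, ht, ht'⟩ := exists_arc_eq hfin hs1
      (c := ℓ / 3) (by linarith) (by linarith)
    have small : ∀ {a b : I}, a ≤ b → (arc β a b).toReal < r.1 →
        Small (rips X r) (Set.range (β.subpath a b)) := by
      intro a b hab h
      rw [Path.range_subpath_of_le _ _ _ hab]
      refine small_rips ?_
      rintro _ ⟨c, hc, rfl⟩ _ ⟨d, hd, rfl⟩
      exact (dist_le_arc hfin hc hd).trans_lt h
    have d1 := dist_le_arc hfin (Set.left_mem_Icc.2 h0s) (Set.right_mem_Icc.2 h0s)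
    have d2 := dist_le_arc hfin (Set.left_mem_Icc.2 hst) (Set.right_mem_Icc.2 hst)
    have d3 := dist_le_arc hfin (Set.left_mem_Icc.2 ht1) (Set.right_mem_Icc.2 ht1)
    have e01 : β 1 = β 0 := β.target.trans β.source.symm
    rw [e01, dist_comm] at d3
    exact ⟨s, t, small h0s (by linarith), small hst (by linarith), small ht1 (by linarith),
      spans_rips (by linarith) (by linarith) (by linarith)⟩

theorem spans_cech {r : Scale} {u v w z : X} (hu : dist u z < r.1) (hv : dist v z < r.1)
    (hw : dist w z < r.1) : Spans (cech X r) u v w := by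
  classical
  refine ⟨{u, v, w}, ⟨by simp, z, ?_⟩, by simp, by simp, by simp⟩
  simp only [Finset.mem_insert, Finset.mem_singleton, Set.mem_iInter, Metric.mem_ball]
  rintro _ (rfl | rfl | rfl) <;> rwa [dist_comm]

theorem exists_of_mem_cech {r : Scale} {s : Finset X} (hs : s ∈ (cech X r).faces) :
    ∃ z, ∀ u ∈ s, dist u z < r.1 := by
  obtain ⟨z, hz⟩ := hs.2
  simp only [Set.mem_iInter, Metric.mem_ball] at hz
  exact ⟨z, fun u hu => by rw [dist_comm]; exact hz u hu⟩

theorem small_cech {r : Scale} {S : Set X} (z : X) (h : ∀ a ∈ S, dist a z < r.1) :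
    Small (cech X r) S :=
  fun a ha b hb c hc => spans_cech (h a ha) (h b hb) (h c hc)

/-- An arc shorter than `2 * r` lies within `r` of its midpoint, so it is small. This applies to the
two halves of a loop shorter than `4 * r` and to a geodesic joining two vertices of a face. -/
theorem isTight_cech (r : Scale) : IsTight (cech X r) (4 * r.1) r.1 := by
  have hr := r.2
  refine ⟨hr, by linarith, fun u => small_cech u fun a ha => ha, ?_, ?_, ?_, ?_⟩
  · intro u v w y hu hv hw
    rw [Metric.mem_ball, dist_comm] at hu hv hw
    exact spans_cech hu hv hw
  · rintro u v w ⟨s, hs, hu, hv, hw⟩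
    obtain ⟨z, hz⟩ := exists_of_mem_cech hs
    have h1 := hz u hu
    have h2 := hz v hv
    have h3 := hz w hw
    have := dist_triangle_right u v z
    have := dist_triangle_right v w z
    have := dist_triangle_right u w z
    refine ⟨z, ?_, ?_, ?_⟩ <;> simp only [dist_comm z] <;> linarith
  · rintro v w ⟨s, hs, hv, hw, -⟩ p hp
    obtain ⟨z, hz⟩ := exists_of_mem_cech hs
    have h1 := hz v hv
    have h2 := hz w hw
    have := dist_triangle_right v w z
    obtain ⟨m, hm⟩ := exists_midpoint hp
    refine small_cech m ?_
    rintro _ ⟨a, rfl⟩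
    have := hm a
    linarith
  · intro y β hβ
    have hfin := hβ.ne_top
    set ℓ := (arc β 0 1).toReal with hℓ
    have hℓ4 : ℓ < 4 * r.1 := by
      rw [hℓ, arc_zero_one]
      exact (ENNReal.lt_ofReal_iff_toReal_lt hfin).1 hβ
    have hℓ0 : 0 ≤ ℓ := ENNReal.toReal_nonneg
    have small : ∀ {a b : I}, a ≤ b → (arc β a b).toReal < 2 * r.1 →
        Small (cech X r) (Set.range (β.subpath a b)) := by
      intro a b hab h
      have h0 : 0 ≤ (arc β a b).toReal := ENNReal.toReal_nonneg
      obtain ⟨m, ham, hmb, h1, h2⟩ := exists_arc_eq hfin hab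
        (c := (arc β a b).toReal / 2) (by linarith) (by linarith)
      rw [Path.range_subpath_of_le _ _ _ hab]
      refine small_cech (β m) ?_
      rintro _ ⟨c, hc, rfl⟩
      rcases le_total c m with hcm | hcm
      · have := dist_le_arc hfin (Set.mem_Icc.2 ⟨hc.1, hcm⟩) (Set.mem_Icc.2 ⟨ham, le_rfl⟩)
        linarith
      · have := dist_le_arc hfin (Set.mem_Icc.2 ⟨hcm, hc.2⟩) (Set.mem_Icc.2 ⟨le_rfl, hmb⟩)
        linarith
    obtain ⟨s, h0s, hs1, hs, hs'⟩ := exists_arc_eq hfin (zero_le_one : (0 : I) ≤ 1)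
      (c := ℓ / 2) (by linarith) (by linarith)
    have hsm := small h0s (by linarith)
    -- Two arcs suffice here: the middle piece is constant, and the three cut points already lie on
    -- the first half.
    refine ⟨s, s, hsm, ?_, small hs1 (by linarith), ?_⟩
    · refine small_cech (β s) ?_
      rw [Path.subpath_self]
      rintro _ ⟨a, rfl⟩
      simpa using hr
    · exact hsm _ ⟨0, by simp⟩ _ ⟨1, by simp⟩ _ ⟨1, by simp⟩

end tight

end RipsCech

/-! ### The geodesic cocycle and holonomy in the metric space. -/

namespace RipsCech

open unitInterval Topology

section

variable {X : Type u} [MetricSpace X]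

/-! ### Classes of rectifiable paths modulo short loops -/

/-- A chosen geodesic between two points. -/
noncomputable def geod (hX : IsGeodesicSpace X) (v w : X) : Path v w :=
  (hX v w).choose

theorem pathLength_geod (hX : IsGeodesicSpace X) (v w : X) :
    pathLength (geod hX v w) = edist v w :=
  (hX v w).choose_spec

theorem pathLength_geod_ne_top (hX : IsGeodesicSpace X) (v w : X) :
    pathLength (geod hX v w) ≠ ⊤ := by
  rw [pathLength_geod]
  exact edist_ne_top v w

theorem geod_self (hX : IsGeodesicSpace X) (v : X) : geod hX v v = Path.refl v :=
  eq_refl_of_pathLength_eq_zero _ (by rw [pathLength_geod, edist_self])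

/-- A homotopy class of paths that contains a rectifiable path. -/
def Rect {y z : X} (γ : Path.Homotopic.Quotient y z) : Prop :=
  ∃ p : Path y z, pathLength p ≠ ⊤ ∧ Path.Homotopic.Quotient.mk p = γ

theorem Rect.mk {y z : X} {p : Path y z} (hp : pathLength p ≠ ⊤) :
    Rect (Path.Homotopic.Quotient.mk p) :=
  ⟨p, hp, rfl⟩

theorem Rect.trans {x y z : X} {γ : Path.Homotopic.Quotient x y}
    {δ : Path.Homotopic.Quotient y z} (hγ : Rect γ) (hδ : Rect δ) : Rect (γ.trans δ) := by
  obtain ⟨p, hp, rfl⟩ := hγ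
  obtain ⟨q, hq, rfl⟩ := hδ
  exact ⟨p.trans q, pathLength_trans_ne_top hp hq, rfl⟩

theorem Rect.symm {x y : X} {γ : Path.Homotopic.Quotient x y} (hγ : Rect γ) : Rect γ.symm := by
  obtain ⟨p, hp, rfl⟩ := hγ
  exact ⟨p.symm, by rwa [pathLength_symm_eq], rfl⟩

variable (hX : IsGeodesicSpace X) (x₀ : X)

open Path.Homotopic.Quotient in
/-- The loop obtained from a path by joining its ends to the base point by geodesics. -/
noncomputable def loopAt {y z : X} (γ : Path.Homotopic.Quotient y z) : FundamentalGroup X x₀ :=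
  FundamentalGroup.fromPath (((mk (geod hX x₀ y)).trans γ).trans (mk (geod hX x₀ z)).symm)

open Path.Homotopic.Quotient in
-- The geodesic to the middle point and back cancels. The factors are reversed because a product in
-- `FundamentalGroup` traverses its right factor first.
theorem loopAt_trans {x y z : X} (γ : Path.Homotopic.Quotient x y)
    (δ : Path.Homotopic.Quotient y z) :
    loopAt hX x₀ (γ.trans δ) = loopAt hX x₀ δ * loopAt hX x₀ γ := by
  simp only [loopAt, FundamentalGroup.mul_def, trans_assoc]
  rw [← trans_assoc (mk (geod hX x₀ y)).symm, symm_trans, refl_trans]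

theorem loopAt_base (γ : Path.Homotopic.Quotient x₀ x₀) :
    loopAt hX x₀ γ = FundamentalGroup.fromPath γ := by
  simp [loopAt, geod_self, quotient_refl_symm]

/-- A finite length is below some natural number, so the loop with constant tail is itself a
generator. -/
theorem fromPath_mem_finPi {γ : Path.Homotopic.Quotient x₀ x₀} (hγ : Rect γ) :
    FundamentalGroup.fromPath γ ∈ finPi X x₀ := by
  obtain ⟨p, hp, rfl⟩ := hγ
  obtain ⟨n, hn⟩ := ENNReal.exists_nat_gt hp
  refine Subgroup.mem_iSup_of_mem n (Subgroup.subset_closure ⟨x₀, Path.refl x₀, p, ?_, ?_, ?_⟩)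
  · rw [pathLength_refl]
    exact ENNReal.zero_ne_top
  · rwa [ENNReal.ofReal_natCast]
  · simp [lasso, Path.Homotopic.Quotient.mk_trans]

theorem rect_of_mem_finPi {c : FundamentalGroup X x₀} (hc : c ∈ finPi X x₀) :
    Rect (FundamentalGroup.toPath c) := by
  obtain ⟨p, hp, rfl⟩ := finPi_le_rectifiablePi X x₀ hc
  exact ⟨p, hp, rfl⟩

theorem loopAt_mem_finPi {y z : X} {γ : Path.Homotopic.Quotient y z} (hγ : Rect γ) :
    loopAt hX x₀ γ ∈ finPi X x₀ :=
  fromPath_mem_finPi x₀ (((Rect.mk (pathLength_geod_ne_top hX _ _)).trans hγ).trans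
    (Rect.mk (pathLength_geod_ne_top hX _ _)).symm)

/-- Rectifiable loops modulo loops of length less than `L`. -/
abbrev QuotPi (X : Type u) [MetricSpace X] (x₀ : X) (L : ℝ) : Type u :=
  finPi X x₀ ⧸ (shortPi X x₀ L).subgroupOf (finPi X x₀)

open Classical in
/-- The class of a rectifiable path in the quotient by the loops of length less than `L`. -/
noncomputable def pathClass (L : ℝ) {y z : X} (γ : Path.Homotopic.Quotient y z) :
    QuotPi X x₀ L :=
  -- The default value 1 plays no role: only rectifiable classes are ever evaluated.
  if h : Rect γ then QuotientGroup.mk ⟨loopAt hX x₀ γ, loopAt_mem_finPi hX x₀ h⟩ else 1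

theorem pathClass_of_rect (L : ℝ) {y z : X} {γ : Path.Homotopic.Quotient y z} (h : Rect γ) :
    pathClass hX x₀ L γ = QuotientGroup.mk ⟨loopAt hX x₀ γ, loopAt_mem_finPi hX x₀ h⟩ :=
  dif_pos h

theorem pathClass_trans (L : ℝ) {x y z : X} {γ : Path.Homotopic.Quotient x y}
    {δ : Path.Homotopic.Quotient y z} (hγ : Rect γ) (hδ : Rect δ) :
    pathClass hX x₀ L (γ.trans δ) = pathClass hX x₀ L δ * pathClass hX x₀ L γ := by
  rw [pathClass_of_rect hX x₀ L hγ, pathClass_of_rect hX x₀ L hδ,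
    pathClass_of_rect hX x₀ L (hγ.trans hδ), ← QuotientGroup.mk_mul]
  congr 1
  exact Subtype.ext (loopAt_trans hX x₀ γ δ)

open Path.Homotopic.Quotient in
-- The two loops differ by the lasso with tail the geodesic from `x₀` to `y` and loop `q.trans
-- p.symm`, which is shorter than `L`.
theorem pathClass_eq_of_short {L : ℝ} {y z : X} (p q : Path y z)
    (h : pathLength p + pathLength q < ENNReal.ofReal L) :
    pathClass hX x₀ L (mk p) = pathClass hX x₀ L (mk q) := by
  have hp : pathLength p ≠ ⊤ := ne_top_of_le_ne_top h.ne_top le_self_add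
  have hq : pathLength q ≠ ⊤ := ne_top_of_le_ne_top h.ne_top le_add_self
  rw [pathClass_of_rect hX x₀ L (Rect.mk hp), pathClass_of_rect hX x₀ L (Rect.mk hq),
    QuotientGroup.eq, Subgroup.mem_subgroupOf]
  refine Subgroup.subset_closure ⟨y, geod hX x₀ y, q.trans p.symm,
    pathLength_geod_ne_top hX _ _, ?_, ?_⟩
  · refine (pathLength_trans_le _ _).trans_lt ?_
    rwa [pathLength_symm_eq, add_comm]
  · change (loopAt hX x₀ (mk p))⁻¹ * loopAt hX x₀ (mk q) = _
    rw [inv_mul_eq_iff_eq_mul]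
    simp only [lasso, loopAt, FundamentalGroup.mul_def, mk_trans, mk_symm, trans_assoc]
    rw [← trans_assoc (mk (geod hX x₀ y)).symm, symm_trans, refl_trans,
      ← trans_assoc (mk p).symm, symm_trans, refl_trans]

/-- The cocycle of classes of geodesics. -/
noncomputable def geodClass (L : ℝ) (v w : X) : QuotPi X x₀ L :=
  pathClass hX x₀ L (Path.Homotopic.Quotient.mk (geod hX v w))

theorem geodClass_triangle {L : ℝ} {u v w : X} (h : dist u v + dist v w + dist u w < L) :
    geodClass hX x₀ L v w * geodClass hX x₀ L u v = geodClass hX x₀ L u w := by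
  rw [geodClass, geodClass, ← pathClass_trans hX x₀ L (Rect.mk (pathLength_geod_ne_top hX _ _))
    (Rect.mk (pathLength_geod_ne_top hX _ _)), ← Path.Homotopic.Quotient.mk_trans]
  refine pathClass_eq_of_short hX x₀ _ _ ?_
  refine (add_le_add_left (pathLength_trans_le _ _) _).trans_lt ?_
  simp only [pathLength_geod, edist_dist]
  rwa [← ENNReal.ofReal_add dist_nonneg dist_nonneg,
    ← ENNReal.ofReal_add (by positivity) dist_nonneg, ENNReal.ofReal_lt_ofReal_iff_of_nonneg]
  positivity

variable {K : AbstractSimplicialComplex X} {L ρ : ℝ}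

/-- The triangle `u v w` may itself be too long. Multiplying by the class of the geodesic from `z`
to `u` reduces the relation to the three short triangles with apex `z`, after which that class
cancels. -/
theorem isCocycle_geodClass (hK : IsTight K L ρ) : IsCocycle K (geodClass hX x₀ L) := by
  intro u v w h
  obtain ⟨z, h1, h2, h3⟩ := hK.triangle u v w h
  have e1 := geodClass_triangle hX x₀ h1
  have e2 := geodClass_triangle hX x₀ h2
  have e3 := geodClass_triangle hX x₀ h3
  rw [← mul_right_cancel_iff (a := geodClass hX x₀ L z u), mul_assoc, e1, e2, e3]

/-! ### Holonomy along paths in the metric space -/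

/-- A cocycle on the complex, seen on the cover of the space by balls. -/
@[simps]
def IsTight.ballCocycle (hK : IsTight K L ρ) {H : Type*} [Group H] {e : X → X → H}
    (he : IsCocycle K e) : CoverCocycle X X H where
  U v := Metric.ball v ρ
  isOpen _ := Metric.isOpen_ball
  cover y := ⟨y, Metric.mem_ball_self hK.pos⟩
  e := e
  cocycle u v w y hu hv hw := he u v w (hK.nerve u v w y hu hv hw)

variable {H : Type*} [Group H] {e : X → X → H}

/-- A neighbourhood basis of convex sets in the unit interval, for points of a small ball. -/
theorem exists_convex_nhds {y z : X} (γ : Path y z) (t : I) {N : Set I} (hN : N ∈ 𝓝 t)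
    (hρ : 0 < ρ) : ∃ O ∈ 𝓝 t, O.OrdConnected ∧ O ⊆ N ∧ O ⊆ γ ⁻¹' Metric.ball (γ t) ρ := by
  obtain ⟨a, b, _, h1, h2⟩ := exists_Icc_mem_subset_of_mem_nhds (Filter.inter_mem hN
    (γ.continuous.continuousAt.preimage_mem_nhds (Metric.ball_mem_nhds (γ t) hρ)))
  exact ⟨Set.Icc a b, h1, Set.ordConnected_Icc, h2.trans Set.inter_subset_left,
    h2.trans Set.inter_subset_right⟩

theorem hol_subpath_ball (hK : IsTight K L ρ) (he : IsCocycle K e) {y z : X} (γ : Path y z)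
    {t a b : I} {O : Set I} (hO : O.OrdConnected) (hOρ : O ⊆ γ ⁻¹' Metric.ball (γ t) ρ)
    (ha : a ∈ O) (hb : b ∈ O) (hab : a ≤ b) :
    (hK.ballCocycle he).hol (γ a) (γ b) (Path.Homotopic.Quotient.mk (γ.subpath a b)) =
      e (γ t) (γ b) * e (γ a) (γ t) := by
  refine (hK.ballCocycle he).hol_of_range (γ t) _ _ _ ?_ (Metric.mem_ball_self hK.pos)
    (Metric.mem_ball_self hK.pos)
  rw [Path.range_subpath_of_le _ _ _ hab]
  exact Set.image_subset_iff.2 ((hO.out ha hb).trans hOρ)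

theorem hol_subpath_trans (hK : IsTight K L ρ) (he : IsCocycle K e) {y z : X} (γ : Path y z)
    (a b c : I) :
    (hK.ballCocycle he).hol (γ a) (γ c) (Path.Homotopic.Quotient.mk (γ.subpath a c)) =
      (hK.ballCocycle he).hol (γ b) (γ c) (Path.Homotopic.Quotient.mk (γ.subpath b c)) *
      (hK.ballCocycle he).hol (γ a) (γ b) (Path.Homotopic.Quotient.mk (γ.subpath a b)) := by
  rw [← subpath_class_trans γ a b c,
    (hK.ballCocycle he).hol_trans _ (γ b) _ _ _ (Metric.mem_ball_self hK.pos)]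

/-- A path with small image has the holonomy of the edge between its ends. -/
theorem hol_of_small (hK : IsTight K L ρ) (he : IsCocycle K e) {y z : X} (γ : Path y z)
    (hγ : Small K (Set.range γ)) :
    (hK.ballCocycle he).hol y z (Path.Homotopic.Quotient.mk γ) = e y z := by
  have hs : ∀ a b c : I, Spans K (γ a) (γ b) (γ c) := fun a b c =>
    hγ _ ⟨a, rfl⟩ _ ⟨b, rfl⟩ _ ⟨c, rfl⟩
  -- The path need not lie in one ball. Locally the holonomy passes through a ball centre on the
  -- path, and smallness of the image makes every triple of its points span, so the local values
  -- multiply up.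
  have := unitInterval_rel_of_local (Q := fun a b => (hK.ballCocycle he).hol (γ a) (γ b)
      (Path.Homotopic.Quotient.mk (γ.subpath a b)) = e (γ a) (γ b))
    (fun a b c _ _ h1 h2 => by
      rw [hol_subpath_trans hK he γ a b c, h1, h2, he _ _ _ (hs a b c)])
    (fun t => by
      obtain ⟨O, hO, hconv, -, hOρ⟩ := exists_convex_nhds γ t Filter.univ_mem hK.pos
      refine ⟨O, hO, fun a ha b hb hab => ?_⟩
      rw [hol_subpath_ball hK he γ hconv hOρ ha hb hab, he _ _ _ (hs a t b)])
  rw [Path.subpath_zero_one] at this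
  exact of_cast_class (P := fun {y z} γ => (hK.ballCocycle he).hol y z γ = e y z)
    (Path.Homotopic.Quotient.mk γ) γ.source γ.target this

theorem hol_geod (hK : IsTight K L ρ) (he : IsCocycle K e) {v w : X} (h : Spans K v w w) :
    (hK.ballCocycle he).hol v w (Path.Homotopic.Quotient.mk (geod hX v w)) = e v w :=
  hol_of_small hK he _ (hK.geodesic v w h _ (pathLength_geod hX v w))

/-- Short loops have trivial holonomy. -/
theorem hol_short_loop (hK : IsTight K L ρ) (he : IsCocycle K e) {y : X} (β : Path y y)
    (hβ : pathLength β < ENNReal.ofReal L) :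
    (hK.ballCocycle he).hol y y (Path.Homotopic.Quotient.mk β) = 1 := by
  obtain ⟨s, t, h1, h2, h3, h4⟩ := hK.loop y β hβ
  have key : (hK.ballCocycle he).hol (β 0) (β 1)
      (Path.Homotopic.Quotient.mk (β.subpath 0 1)) = e (β 0) (β 1) := by
    rw [hol_subpath_trans hK he β 0 t 1, hol_subpath_trans hK he β 0 s t, hol_of_small hK he _ h1,
      hol_of_small hK he _ h2, hol_of_small hK he _ h3, he _ _ _ h4]
    have e01 : β 1 = β 0 := β.target.trans β.source.symm
    have h5 : Spans K (β 0) (β t) (β 0) := by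
      obtain ⟨s, hs, h, -, h'⟩ := h4
      exact ⟨s, hs, h, h', h⟩
    rw [e01, he _ _ _ h5]
  rw [Path.subpath_zero_one] at key
  have hy : e y y = 1 := (hK.ballCocycle he).e_self (v := y) (Metric.mem_ball_self hK.pos)
  rw [← hy]
  exact of_cast_class (P := fun {y z} γ => (hK.ballCocycle he).hol y z γ = e y z)
    (Path.Homotopic.Quotient.mk β) β.source β.target key

/-- The holonomy of the geodesic cocycle along a rectifiable path is the class of the path. -/
theorem hol_geodClass (hK : IsTight K L ρ) {y z : X} (γ : Path y z) (hγ : pathLength γ ≠ ⊤) :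
    (hK.ballCocycle (isCocycle_geodClass hX x₀ hK)).hol y z (Path.Homotopic.Quotient.mk γ) =
      pathClass hX x₀ L (Path.Homotopic.Quotient.mk γ) := by
  set he := isCocycle_geodClass hX x₀ hK
  have hrect : ∀ a b : I, a ≤ b → Rect (Path.Homotopic.Quotient.mk (γ.subpath a b)) :=
    fun a b hab => Rect.mk (ne_top_of_le_ne_top (arc_ne_top hγ a b) (pathLength_subpath_le γ hab))
  have := unitInterval_rel_of_local (Q := fun a b => (hK.ballCocycle he).hol (γ a) (γ b)
      (Path.Homotopic.Quotient.mk (γ.subpath a b)) =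
        pathClass hX x₀ L (Path.Homotopic.Quotient.mk (γ.subpath a b)))
    (fun a b c hab hbc h1 h2 => by
      rw [hol_subpath_trans hK he γ a b c, h1, h2, ← subpath_class_trans γ a b c,
        pathClass_trans hX x₀ L (hrect a b hab) (hrect b c hbc)])
    (fun t => by
      -- Near `t`, the subpath is compared with the two geodesics through `γ t`. The loop they form
      -- has length below `ρ + ρ + (L - 2 * ρ) = L`; rectifiability makes the subpath that short.
      have hlt := hK.lt
      obtain ⟨N, hN, harc⟩ := exists_nhds_arc_lt hγ t
        (ENNReal.ofReal_pos.2 (show 0 < L - 2 * ρ by linarith))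
      obtain ⟨O, hO, hconv, hON, hOρ⟩ := exists_convex_nhds γ t hN hK.pos
      refine ⟨O, hO, fun a ha b hb hab => ?_⟩
      rw [hol_subpath_ball hK he γ hconv hOρ ha hb hab, geodClass, geodClass,
        ← pathClass_trans hX x₀ L (Rect.mk (pathLength_geod_ne_top hX _ _))
          (Rect.mk (pathLength_geod_ne_top hX _ _)), ← Path.Homotopic.Quotient.mk_trans]
      refine pathClass_eq_of_short hX x₀ _ _ ?_
      have h1 := pathLength_subpath_le γ hab
      have h2 := harc a (hON ha) b (hON hb)
      have h3 : dist (γ a) (γ t) < ρ := hOρ ha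
      have h4 : dist (γ b) (γ t) < ρ := hOρ hb
      rw [dist_comm] at h4
      calc _ ≤ edist (γ a) (γ t) + edist (γ t) (γ b) + arc γ a b := by
            refine add_le_add ((pathLength_trans_le _ _).trans_eq ?_) h1
            rw [pathLength_geod, pathLength_geod]
        _ < ENNReal.ofReal ρ + ENNReal.ofReal ρ + ENNReal.ofReal (L - 2 * ρ) := by
            rw [edist_dist, edist_dist]
            exact ENNReal.add_lt_add (ENNReal.add_lt_add
              ((ENNReal.ofReal_lt_ofReal_iff hK.pos).2 h3)
              ((ENNReal.ofReal_lt_ofReal_iff hK.pos).2 h4)) h2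
        _ = ENNReal.ofReal L := by
            rw [← ENNReal.ofReal_add hK.pos.le hK.pos.le,
              ← ENNReal.ofReal_add (by linarith [hK.pos]) (by linarith)]
            congr 1
            ring)
  rw [Path.subpath_zero_one] at this
  exact of_cast_class (P := fun {y z} γ => (hK.ballCocycle he).hol y z γ = pathClass hX x₀ L γ)
    (Path.Homotopic.Quotient.mk γ) γ.source γ.target this

end
end RipsCech

/-! ### The comparison isomorphism on fundamental groups. -/

namespace RipsCech

open unitInterval Topology Realization

/-! ### The fundamental group of a tight complex -/

/-- The edge cocycle with values in the fundamental group of the realization. -/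
theorem exists_edge_cocycle {V : Type u} {K : AbstractSimplicialComplex V} (x₀ : V)
    (θ : ∀ v, Path.Homotopic.Quotient (vertex K x₀) (vertex K v)) :
    ∃ e : V → V → FundamentalGroup (Realization K) (vertex K x₀), IsCocycle K e ∧
      ∀ v w (h : Spans K v w w), e v w =
        FundamentalGroup.fromPath (((θ v).trans (line (near_vertices h))).trans (θ w).symm) := by
  classical
  refine ⟨fun v w => if h : Spans K v w w then
    FundamentalGroup.fromPath (((θ v).trans (line (near_vertices h))).trans (θ w).symm) else 1,
    ?_, fun v w h => dif_pos h⟩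
  rintro u v w ⟨s, hs, hu, hv, hw⟩
  have h1 : Spans K v w w := ⟨s, hs, hv, hw, hw⟩
  have h2 : Spans K u v v := ⟨s, hs, hu, hv, hv⟩
  have h3 : Spans K u w w := ⟨s, hs, hu, hw, hw⟩
  simp only [dif_pos h1, dif_pos h2, dif_pos h3]
  rw [FundamentalGroup.mul_def,
    ← line_trans hs (vertex_mem_closedSimplex hu) (vertex_mem_closedSimplex hv)
      (vertex_mem_closedSimplex hw) (near_vertices h2) (near_vertices h1) (near_vertices h3)]
  simp only [Path.Homotopic.Quotient.trans_assoc]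
  rw [← Path.Homotopic.Quotient.trans_assoc (θ v).symm, Path.Homotopic.Quotient.symm_trans,
    Path.Homotopic.Quotient.refl_trans]

section

variable {X : Type u} [MetricSpace X] (hX : IsGeodesicSpace X) (x₀ : X)
variable {K : AbstractSimplicialComplex X} {L ρ : ℝ}

-- The realization is path connected: a geodesic from `x₀` is divided into pieces lying in balls of
-- radius `ρ`, and two points of such a ball span an edge.
include hX in
theorem exists_vertex_paths (hK : IsTight K L ρ) :
    ∃ θ : ∀ v, Path.Homotopic.Quotient (vertex K x₀) (vertex K v),
      θ x₀ = Path.Homotopic.Quotient.refl _ := by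
  have h : ∀ v, Nonempty (Path.Homotopic.Quotient (vertex K x₀) (vertex K v)) := by
    intro v
    refine cover_induction (U := fun v : X => Metric.ball v ρ)
      (P := fun {y z} _ => Nonempty (Path.Homotopic.Quotient (vertex K y) (vertex K z)))
      (fun _ => Metric.isOpen_ball) (fun y => ⟨y, Metric.mem_ball_self hK.pos⟩) ?_ ?_
      (Path.Homotopic.Quotient.mk (geod hX x₀ v))
    · intro u y z γ hγ
      have hy : y ∈ Metric.ball u ρ := hγ ⟨0, γ.source⟩
      have hz : z ∈ Metric.ball u ρ := hγ ⟨1, γ.target⟩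
      exact ⟨line (near_vertices (hK.ball u _ hy _ hz _ hz))⟩
    · rintro x y z - - ⟨p⟩ ⟨q⟩
      exact ⟨p.trans q⟩
  -- Normalised to be trivial at `x₀`, so that no gauge factor is left at the base vertex.
  refine ⟨fun v => (h x₀).some.symm.trans (h v).some, ?_⟩
  exact Path.Homotopic.Quotient.symm_trans _

/-- Holonomy along loops, as a homomorphism on the fundamental group. -/
noncomputable def CoverCocycle.holHom {V Y H : Type*} [TopologicalSpace Y] [Group H]
    (c : CoverCocycle V Y H) {y : Y} {v : V} (hy : y ∈ c.U v) : FundamentalGroup Y y →* H where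
  toFun γ := c.hol v v (FundamentalGroup.toPath γ)
  map_one' := by
    change c.hol v v (Path.Homotopic.Quotient.refl y) = 1
    rw [c.hol_refl hy hy, c.e_self hy]
  map_mul' p q := c.hol_trans v v v (FundamentalGroup.toPath q) (FundamentalGroup.toPath p) hy

/-- The comparison homomorphism from the fundamental group of a tight complex. -/
noncomputable def piHol (hK : IsTight K L ρ) :
    FundamentalGroup (Realization K) (vertex K x₀) →* QuotPi X x₀ L :=
  (starCocycle (isCocycle_geodClass hX x₀ hK)).holHom (vertex_mem_star x₀)

/-- The inverse `φ'` is the holonomy of the edge cocycle along rectifiable loops of `X`, which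
factors through the quotient because short loops have trivial holonomy. Each map takes one cocycle
to the other up to gauge, and each cocycle is tautological on its own space. -/
theorem piHol_bijective (hK : IsTight K L ρ) : Function.Bijective (piHol hX x₀ hK) := by
  obtain ⟨θ, hθ⟩ := exists_vertex_paths hX x₀ hK
  obtain ⟨e, he, heθ⟩ := exists_edge_cocycle x₀ θ
  set hg := isCocycle_geodClass hX x₀ hK
  have hball : ∀ y : X, y ∈ Metric.ball y ρ := fun y => Metric.mem_ball_self hK.pos
  let φ : FundamentalGroup X x₀ →* FundamentalGroup (Realization K) (vertex K x₀) :=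
    (hK.ballCocycle he).holHom (hball x₀)
  have φ_apply : ∀ γ : Path.Homotopic.Quotient x₀ x₀, φ (FundamentalGroup.fromPath γ) =
    (hK.ballCocycle he).hol x₀ x₀ γ := fun γ => rfl
  have hφ_short : shortPi X x₀ L ≤ φ.ker := by
    refine (Subgroup.closure_le _).2 ?_
    rintro _ ⟨y, α, β, -, hβ, rfl⟩
    rw [SetLike.mem_coe, MonoidHom.mem_ker, lasso, φ_apply, Path.Homotopic.Quotient.mk_trans,
      Path.Homotopic.Quotient.mk_trans, Path.Homotopic.Quotient.mk_symm,
      (hK.ballCocycle he).hol_trans _ y _ _ _ (hball y),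
      (hK.ballCocycle he).hol_trans _ y _ _ _ (hball y), hol_short_loop hK he β hβ,
      (hK.ballCocycle he).hol_symm _ (hball x₀) (hball y), one_mul, inv_mul_cancel]
  let φ' : QuotPi X x₀ L →* FundamentalGroup (Realization K) (vertex K x₀) :=
    QuotientGroup.lift _ (φ.comp (finPi X x₀).subtype) (fun c hc => hφ_short hc)
  -- The gauge is the holonomy along the geodesics from `x₀`, which enter through `loopAt`. The
  -- counterpart `hψ_e` below uses the chosen paths `θ` instead.
  have hφ_e : ∀ v w, Spans K v w w → φ' (geodClass hX x₀ L v w) =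
      ((hK.ballCocycle he).hol x₀ w (Path.Homotopic.Quotient.mk (geod hX x₀ w)))⁻¹ * e v w *
      ((hK.ballCocycle he).hol x₀ v (Path.Homotopic.Quotient.mk (geod hX x₀ v))) := by
    intro v w h
    rw [geodClass, pathClass_of_rect hX x₀ L (Rect.mk (pathLength_geod_ne_top hX v w))]
    change φ (loopAt hX x₀ (Path.Homotopic.Quotient.mk (geod hX v w))) = _
    rw [loopAt, φ_apply, (hK.ballCocycle he).hol_trans _ w _ _ _ (hball w),
      (hK.ballCocycle he).hol_trans _ v _ _ _ (hball v), hol_geod hX hK he h,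
      (hK.ballCocycle he).hol_symm _ (hball x₀) (hball w), mul_assoc]
  have hψ_e : ∀ v w, Spans K v w w → piHol hX x₀ hK (e v w) =
      ((starCocycle hg).hol x₀ w (θ w))⁻¹ * geodClass hX x₀ L v w *
      ((starCocycle hg).hol x₀ v (θ v)) := by
    intro v w h
    rw [heθ v w h]
    change (starCocycle hg).hol x₀ x₀ _ = _
    rw [(starCocycle hg).hol_trans _ w _ _ _ (vertex_mem_star w),
      (starCocycle hg).hol_trans _ v _ _ _ (vertex_mem_star v), hol_line hg h,
      (starCocycle hg).hol_symm _ (vertex_mem_star x₀) (vertex_mem_star w), mul_assoc]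
  have left : ∀ c, φ' (piHol hX x₀ hK c) = c := by
    intro c
    have h := CoverCocycle.hol_gauge (starCocycle hg) (starCocycle he) φ'
      (fun v => ((hK.ballCocycle he).hol x₀ v (Path.Homotopic.Quotient.mk (geod hX x₀ v)))⁻¹)
      (fun v y hy => hy) (fun v w y hv hw => by
        rw [inv_inv]
        exact hφ_e v w (spans_of_mem_star hv hw hw))
      (FundamentalGroup.toPath c) (vertex_mem_star x₀) (vertex_mem_star x₀)
    change φ' ((starCocycle hg).hol x₀ x₀ (FundamentalGroup.toPath c)) = c
    -- The geodesic from `x₀` to itself and `θ x₀` are both constant, so every correction at the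
    -- base vertex disappears.
    rw [h, geod_self, Path.Homotopic.Quotient.mk_refl,
      (hK.ballCocycle he).hol_refl (hball x₀) (hball x₀),
      (hK.ballCocycle he).e_self (hball x₀), inv_one, inv_one, one_mul, mul_one,
      hol_eq_class he θ heθ _ (vertex_mem_star x₀) (vertex_mem_star x₀), hθ, line_self,
      quotient_refl_symm]
    simp
  have right : ∀ c, piHol hX x₀ hK (φ' c) = c := by
    intro c
    obtain ⟨⟨c, hc⟩, rfl⟩ := QuotientGroup.mk_surjective c
    -- A rectifiable representative is needed in order to apply `hol_geodClass`.
    obtain ⟨p, hp, hpc⟩ := rect_of_mem_finPi x₀ hc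
    have h := CoverCocycle.hol_gauge (hK.ballCocycle he) (hK.ballCocycle hg)
      (piHol hX x₀ hK) (fun v => ((starCocycle hg).hol x₀ v (θ v))⁻¹)
      (fun v y hy => hy) (fun v w y hv hw => by
        rw [inv_inv]
        exact hψ_e v w (hK.nerve v w w y hv hw hw))
      (Path.Homotopic.Quotient.mk p) (hball x₀) (hball x₀)
    change piHol hX x₀ hK (φ c) = _
    change piHol hX x₀ hK ((hK.ballCocycle he).hol x₀ x₀ (FundamentalGroup.toPath c)) = _
    rw [← hpc, h, hθ, (starCocycle hg).hol_refl (vertex_mem_star x₀) (vertex_mem_star x₀),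
      (starCocycle hg).e_self (vertex_mem_star x₀), inv_one, inv_one, one_mul, mul_one,
      hol_geodClass hX x₀ hK p hp, pathClass_of_rect hX x₀ L (Rect.mk hp)]
    exact congrArg QuotientGroup.mk (Subtype.ext ((loopAt_base hX x₀ _).trans hpc))
  exact ⟨Function.LeftInverse.injective left, Function.RightInverse.surjective right⟩

/-- The inclusion sends the star of a vertex into its star, and the quotient map takes the class of
each geodesic modulo `L` to its class modulo `L'`; so `hol_map` applies with trivial gauge. -/
theorem piHol_inclusion {K' : AbstractSimplicialComplex X} {L' ρ' : ℝ} (hK : IsTight K L ρ)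
    (hK' : IsTight K' L' ρ') (hKK' : K ≤ K') (hL : L ≤ L')
    (c : FundamentalGroup (Realization K) (vertex K x₀)) :
    piHol hX x₀ hK' (FundamentalGroup.map (inclusion hKK') _ c) =
      QuotientGroup.map _ _ (MonoidHom.id (finPi X x₀))
        (fun _ h => shortPi_mono X x₀ hL h) (piHol hX x₀ hK c) := by
  have h := CoverCocycle.hol_map (starCocycle (isCocycle_geodClass hX x₀ hK))
    (starCocycle (isCocycle_geodClass hX x₀ hK')) (inclusion hKK')
    (QuotientGroup.map ((shortPi X x₀ L).subgroupOf (finPi X x₀))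
      ((shortPi X x₀ L').subgroupOf (finPi X x₀)) (MonoidHom.id (finPi X x₀))
      (fun _ h => shortPi_mono X x₀ hL h)) (fun _ => 1)
    (fun v y hy => hy) (fun v w y hv hw => by
      have hr := Rect.mk (pathLength_geod_ne_top hX v w)
      simp only [starCocycle_e, geodClass]
      rw [pathClass_of_rect hX x₀ L hr, pathClass_of_rect hX x₀ L' hr, inv_one, one_mul, mul_one]
      rfl)
    (FundamentalGroup.toPath c) (vertex_mem_star x₀) (vertex_mem_star x₀)
  rw [inv_one, one_mul, mul_one] at h
  exact h.symm

end

/-- The natural isomorphism for a family of tight complexes. -/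
noncomputable def piIso {X : Type u} [MetricSpace X] (hX : IsGeodesicSpace X) (x₀ : X)
    (F : Scale ⥤ AbstractSimplicialComplex X) (a : Scale ⥤ Scale) (ρ : Scale → ℝ)
    (hF : ∀ r, IsTight (F.obj r) (a.obj r).1 (ρ r)) :
    F ⋙ piOne x₀ ≅ a ⋙ quotientPi X x₀ :=
  NatIso.ofComponents
    (fun r => MulEquiv.toGrpIso (MulEquiv.ofBijective (piHol hX x₀ (hF r))
      (piHol_bijective hX x₀ (hF r))))
    (fun {r s} f => by
      ext c
      exact piHol_inclusion hX x₀ (hF r) (hF s) (F.map f).le (a.map f).le c)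

end RipsCech

/-! ### One-chains modulo boundaries and singular paths. -/

namespace RipsCech

open unitInterval Topology Simplicial

/-! ### One-dimensional opcycles of a simplicial set -/

section opcycles

variable {S : SSet.{u}} {G A : AddCommGrpCat.{u}}

/-- The class of a 1-simplex in the 1-chains modulo boundaries. -/
noncomputable def edgeClass (G : AddCommGrpCat.{u}) (x : S _⦋1⦌) :
    G ⟶ (S.chainComplex G).opcycles 1 :=
  S.ιChainComplex x ≫ (S.chainComplex G).pOpcycles 1

theorem edgeClass_δ (τ : S _⦋2⦌) :
    edgeClass G (S.δ 1 τ) = edgeClass G (S.δ 0 τ) + edgeClass G (S.δ 2 τ) := by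
  have h : S.ιChainComplex (R := G) τ ≫ (S.chainComplex G).d 2 1 ≫
      (S.chainComplex G).pOpcycles 1 = 0 := by simp
  rw [SSet.ιChainComplex_d_assoc, Fin.sum_univ_three] at h
  simp only [Preadditive.add_comp, Preadditive.zsmul_comp] at h
  simp only [edgeClass]
  rw [← sub_eq_zero, ← neg_eq_zero, ← h]
  simp
  abel

theorem opcycles_hom_ext {f g : (S.chainComplex G).opcycles 1 ⟶ A}
    (h : ∀ x : S _⦋1⦌, edgeClass G x ≫ f = edgeClass G x ≫ g) : f = g := by
  rw [← cancel_epi ((S.chainComplex G).pOpcycles 1)]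
  refine SSet.chainComplex_hom_ext fun x => ?_
  simpa [edgeClass] using h x

/-- A function on 1-simplices that is additive on 2-simplices extends to the opcycles. -/
theorem exists_descEdge (f : S _⦋1⦌ → (G ⟶ A))
    (hf : ∀ τ : S _⦋2⦌, f (S.δ 1 τ) = f (S.δ 0 τ) + f (S.δ 2 τ)) :
    ∃ F : (S.chainComplex G).opcycles 1 ⟶ A, ∀ x, edgeClass G x ≫ F = f x := by
  let k : (S.chainComplex G).X 1 ⟶ A :=
    Limits.Cofan.IsColimit.desc (S.isColimitChainComplexXCofan G 1) f
  have hk : ∀ x, S.ιChainComplex x ≫ k = f x := fun x =>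
    Limits.Cofan.IsColimit.fac (S.isColimitChainComplexXCofan G 1) f x
  have hd : (S.chainComplex G).d 2 1 ≫ k = 0 := by
    refine SSet.chainComplex_hom_ext fun τ => ?_
    rw [SSet.ιChainComplex_d_assoc, Fin.sum_univ_three]
    simp only [Preadditive.add_comp, Preadditive.zsmul_comp, hk, hf τ, Limits.comp_zero]
    simp
  refine ⟨(S.chainComplex G).descOpcycles k 2 (by simp) hd, fun x => ?_⟩
  rw [edgeClass, Category.assoc, HomologicalComplex.p_descOpcycles, hk]

theorem edgeClass_fromOpcycles (x : S _⦋1⦌) :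
    edgeClass G x ≫ (S.chainComplex G).fromOpcycles 1 0 =
      S.ιChainComplex (S.δ 0 x) - S.ιChainComplex (S.δ 1 x) := by
  rw [edgeClass, Category.assoc, HomologicalComplex.p_fromOpcycles, SSet.ιChainComplex_d,
    Fin.sum_univ_two]
  simp [sub_eq_add_neg]

end opcycles

/-! ### Singular 1-simplices and paths -/

section singular

variable {X : Type u} [TopologicalSpace X] {G : AddCommGrpCat.{u}}

/-- The point with parameter `t` of the edge from vertex `i` to vertex `j` of the triangle. -/
noncomputable def edgePoint (i j : Fin 3) (t : I) : stdSimplex ℝ (Fin 3) :=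
  stdSimplex.map ![i, j] (stdSimplexHomeomorphUnitInterval.symm t)

theorem continuous_edgePoint (i j : Fin 3) : Continuous (edgePoint i j) :=
  (stdSimplex.continuous_map _).comp (Homeomorph.continuous _)

theorem edgePoint_apply (i j k : Fin 3) (t : I) :
    (edgePoint i j t).1 k = (if i = k then 1 - (t : ℝ) else 0) + (if j = k then (t : ℝ) else 0) := by
  change (stdSimplex.map ![i, j] (stdSimplexHomeomorphUnitInterval.symm t)) k = _
  rw [stdSimplex.map_coe]
  simp [FunOnFinite.linearMap_apply_apply, Finset.sum_filter, Fin.sum_univ_two]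
  rfl

/-- A triangle in a space, viewed as a singular simplex. -/
noncomputable def triangleSimplex (F : C(stdSimplex ℝ (Fin 3), X)) :
    (TopCat.toSSet.obj (TopCat.of X)) _⦋2⦌ :=
  ((TopCat.of X).toSSetObjEquiv (.op ⦋2⦌)).symm F

/-- `k.succAbove` lists the two vertices other than `k` in increasing order, which is the
orientation of the `k`-th face. -/
theorem δ_triangleSimplex (F : C(stdSimplex ℝ (Fin 3), X)) (k : Fin 3)
    {y z : X} (p : Path y z) (hp : ∀ t, F (edgePoint (k.succAbove 0) (k.succAbove 1) t) = p t) :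
    (TopCat.toSSet.obj (TopCat.of X)).δ k (triangleSimplex F) = (pathSimplex p).edge := by
  apply ((TopCat.of X).toSSetObjEquiv (.op ⦋1⦌)).injective
  ext x
  have h1 : ((TopCat.of X).toSSetObjEquiv (.op ⦋1⦌)) (pathSimplex p).edge x =
    p (stdSimplexHomeomorphUnitInterval x) := rfl
  rw [h1, ← hp]
  have h2 : edgePoint (k.succAbove 0) (k.succAbove 1) (stdSimplexHomeomorphUnitInterval x) =
      stdSimplex.map (k.succAbove) x := by
    rw [edgePoint, Homeomorph.symm_apply_apply]
    congr 1
    ext i : 1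
    fin_cases i <;> rfl
  rw [h2]
  rfl

theorem edgeClass_triangle (F : C(stdSimplex ℝ (Fin 3), X)) {a b c d e f : X} (p : Path a b)
    (q : Path c d) (r : Path e f) (hp : ∀ t, F (edgePoint 0 1 t) = p t)
    (hq : ∀ t, F (edgePoint 1 2 t) = q t) (hr : ∀ t, F (edgePoint 0 2 t) = r t) :
    edgeClass G (pathSimplex r).edge =
      edgeClass G (pathSimplex q).edge + edgeClass G (pathSimplex p).edge := by
  rw [← δ_triangleSimplex F 2 p hp, ← δ_triangleSimplex F 0 q hq, ← δ_triangleSimplex F 1 r hr,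
    edgeClass_δ]

/-- The constant triangle has three equal edges, so the class `c` satisfies `c = c + c`. -/
theorem edgeClass_refl (y : X) : edgeClass G (pathSimplex (Path.refl y)).edge = 0 := by
  have h := edgeClass_triangle (G := G) (ContinuousMap.const _ y) (Path.refl y) (Path.refl y)
    (Path.refl y) (fun _ => rfl) (fun _ => rfl) (fun _ => rfl)
  simpa using h

/-- The affine map from the triangle to `I` with values 0, 1/2, 1 at the vertices, followed by
`p.trans q`, has edges `p`, `q` and `p.trans q`. -/
theorem edgeClass_trans {x y z : X} (p : Path x y) (q : Path y z) :
    edgeClass G (pathSimplex (p.trans q)).edge =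
      edgeClass G (pathSimplex q).edge + edgeClass G (pathSimplex p).edge := by
  let F : C(stdSimplex ℝ (Fin 3), X) := ⟨fun s => (p.trans q).extend (s.1 1 / 2 + s.1 2), by
    refine (p.trans q).continuous_extend.comp ?_
    have h1 : Continuous fun s : stdSimplex ℝ (Fin 3) => s.1 1 :=
      (continuous_apply 1).comp continuous_subtype_val
    have h2 : Continuous fun s : stdSimplex ℝ (Fin 3) => s.1 2 :=
      (continuous_apply 2).comp continuous_subtype_val
    exact (h1.div_const 2).add h2⟩
  have hF : ∀ s, F s = (p.trans q).extend (s.1 1 / 2 + s.1 2) := fun s => rfl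
  refine edgeClass_triangle F p q (p.trans q) (fun t => ?_) (fun t => ?_) (fun t => ?_)
  · rw [hF, edgePoint_apply, edgePoint_apply]
    have ht : (t : ℝ) / 2 ∈ I := ⟨by linarith [t.2.1], by linarith [t.2.2]⟩
    simp only [Fin.isValue, zero_ne_one, if_false, zero_add, if_true, Fin.reduceEq, add_zero]
    rw [Path.extend_apply _ ht, Path.trans_apply, dif_pos (by linarith [t.2.2])]
    congr 1
    ext
    simp only
    ring
  · rw [hF, edgePoint_apply, edgePoint_apply]
    simp only [Fin.isValue, if_false, zero_add, if_true, Fin.reduceEq, add_zero]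
    have ht : (1 - (t : ℝ)) / 2 + t ∈ I :=
      ⟨by linarith [t.2.1, t.2.2], by linarith [t.2.1, t.2.2]⟩
    rw [Path.extend_apply _ ht, Path.trans_apply]
    -- The first branch occurs only at `t = 0`, where both halves of `p.trans q` give the common
    -- point.
    split_ifs with h
    · have h' : (t : ℝ) ≤ 0 := by
        have h2 : (1 - (t : ℝ)) / 2 + t ≤ 1 / 2 := h
        linarith
      have h0 : t = 0 := Subtype.ext (le_antisymm h' t.2.1)
      subst h0
      have : (⟨2 * ((1 - ((0 : I) : ℝ)) / 2 + ((0 : I) : ℝ)), (unitInterval.mul_pos_mem_iff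
        zero_lt_two).2 ⟨ht.1, h⟩⟩ : I) = 1 := Subtype.ext (by simp)
      rw [this]
      simp
    · congr 1
      ext
      simp only
      ring
  · rw [hF, edgePoint_apply, edgePoint_apply]
    simp only [Fin.isValue, if_false, zero_add, if_true, Fin.reduceEq, add_zero, zero_div,
      zero_ne_one]
    rw [Path.extend_apply _ t.2]

/-- The square of the homotopy is cut along its diagonal `D`. Each half is a triangle with one
constant side, so the classes of `p` and `q` both equal that of `D`. -/
theorem edgeClass_eq_of_homotopic {y z : X} {p q : Path y z} (h : p.Homotopic q) :
    edgeClass G (pathSimplex p).edge = edgeClass G (pathSimplex q).edge := by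
  obtain ⟨H⟩ := h
  let D : Path y z := ⟨⟨fun t => H (t, t), by fun_prop⟩, by simp, by simp⟩
  let pr : ℝ → I := Set.projIcc 0 1 zero_le_one
  have hpr : Continuous pr := continuous_projIcc
  have hpr_val : ∀ t : I, pr t = t := fun t => Set.projIcc_val zero_le_one t
  have c1 : Continuous fun s : stdSimplex ℝ (Fin 3) => s.1 1 :=
    (continuous_apply 1).comp continuous_subtype_val
  have c2 : Continuous fun s : stdSimplex ℝ (Fin 3) => s.1 2 :=
    (continuous_apply 2).comp continuous_subtype_val
  let F₁ : C(stdSimplex ℝ (Fin 3), X) := ⟨fun s => H (pr (s.1 2), pr (s.1 1 + s.1 2)),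
    H.continuous.comp ((hpr.comp c2).prodMk (hpr.comp (c1.add c2)))⟩
  let F₂ : C(stdSimplex ℝ (Fin 3), X) := ⟨fun s => H (pr (s.1 1 + s.1 2), pr (s.1 2)),
    H.continuous.comp ((hpr.comp (c1.add c2)).prodMk (hpr.comp c2))⟩
  have hF₁ : ∀ s, F₁ s = H (pr (s.1 2), pr (s.1 1 + s.1 2)) := fun s => rfl
  have hF₂ : ∀ s, F₂ s = H (pr (s.1 1 + s.1 2), pr (s.1 2)) := fun s => rfl
  have pr0 : pr 0 = 0 := hpr_val 0
  have pr1 : pr 1 = 1 := hpr_val 1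
  have e1 := edgeClass_triangle (G := G) F₁ p (Path.refl z) D
    (fun t => by rw [hF₁]; simp [edgePoint_apply, hpr_val, pr0])
    (fun t => by rw [hF₁]; simp [edgePoint_apply, pr1])
    (fun t => by rw [hF₁]; simp [edgePoint_apply, hpr_val, D])
  have e2 := edgeClass_triangle (G := G) F₂ (Path.refl y) q D
    (fun t => by rw [hF₂]; simp [edgePoint_apply, pr0])
    (fun t => by rw [hF₂]; simp [edgePoint_apply, hpr_val, pr1])
    (fun t => by rw [hF₂]; simp [edgePoint_apply, hpr_val, D])
  rw [edgeClass_refl, zero_add] at e1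
  rw [edgeClass_refl, add_zero] at e2
  rw [← e1, e2]

/-- The class of a homotopy class of paths in the 1-chains modulo boundaries. -/
noncomputable def quotClass (G : AddCommGrpCat.{u}) {y z : X} (γ : Path.Homotopic.Quotient y z) :
    G ⟶ ((TopCat.toSSet.obj (TopCat.of X)).chainComplex G).opcycles 1 :=
  Quotient.lift (fun p => edgeClass G (pathSimplex p).edge)
    (fun _ _ h => edgeClass_eq_of_homotopic h) γ

theorem quotClass_trans {x y z : X} (γ : Path.Homotopic.Quotient x y)
    (δ : Path.Homotopic.Quotient y z) :
    quotClass G (γ.trans δ) = quotClass G δ + quotClass G γ := by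
  rcases γ with ⟨p⟩
  rcases δ with ⟨q⟩
  exact edgeClass_trans p q

theorem quotClass_symm {x y : X} (γ : Path.Homotopic.Quotient x y) :
    quotClass G γ.symm = - quotClass G γ := by
  rw [eq_neg_iff_add_eq_zero, ← quotClass_trans, Path.Homotopic.Quotient.trans_symm]
  exact edgeClass_refl x

/-- The parametrization of a singular 1-simplex by the unit interval. -/
noncomputable def simplexMap (x : (TopCat.toSSet.obj (TopCat.of X)) _⦋1⦌) : C(I, X) :=
  (((TopCat.of X).toSSetObjEquiv (.op ⦋1⦌)) x).comp
    (toContinuousMap stdSimplexHomeomorphUnitInterval.symm)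

/-- The path underlying a singular 1-simplex. -/
noncomputable def simplexPath (x : (TopCat.toSSet.obj (TopCat.of X)) _⦋1⦌) :
    Path (simplexMap x 0) (simplexMap x 1) :=
  ⟨simplexMap x, rfl, rfl⟩

theorem simplexMap_pathSimplex {y z : X} (p : Path y z) (t : I) :
    simplexMap (pathSimplex p).edge t = p t := by
  change p (stdSimplexHomeomorphUnitInterval (stdSimplexHomeomorphUnitInterval.symm t)) = _
  rw [Homeomorph.apply_symm_apply]

/-- A property of the path underlying a singular simplex that does not see its ends. -/
theorem simplexPath_pathSimplex {y z : X} (p : Path y z)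
    (P : ∀ {y z : X}, Path.Homotopic.Quotient y z → Prop)
    (h : P (Path.Homotopic.Quotient.mk p)) :
    P (Path.Homotopic.Quotient.mk (simplexPath (pathSimplex p).edge)) := by
  have key : ∀ (y' z' : X) (q : Path y' z'), (∀ t, q t = p t) →
      P (Path.Homotopic.Quotient.mk q) := by
    intro y' z' q hq
    obtain rfl : y' = y := by rw [← q.source, hq, p.source]
    obtain rfl : z' = z := by rw [← q.target, hq, p.target]
    obtain rfl : q = p := Path.ext (funext hq)
    exact h
  exact key _ _ _ (simplexMap_pathSimplex p)

/-- The boundary of a singular triangle, as a homotopy relation between paths. -/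
theorem exists_triangle_paths (τ : (TopCat.toSSet.obj (TopCat.of X)) _⦋2⦌) :
    ∃ (a b c : X) (p : Path a b) (q : Path b c) (r : Path a c),
      (TopCat.toSSet.obj (TopCat.of X)).δ 2 τ = (pathSimplex p).edge ∧
      (TopCat.toSSet.obj (TopCat.of X)).δ 0 τ = (pathSimplex q).edge ∧
      (TopCat.toSSet.obj (TopCat.of X)).δ 1 τ = (pathSimplex r).edge ∧
      (Path.Homotopic.Quotient.mk p).trans (Path.Homotopic.Quotient.mk q) =
        Path.Homotopic.Quotient.mk r := by
  obtain ⟨F, rfl⟩ : ∃ F, triangleSimplex F = τ :=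
    ⟨_, ((TopCat.of X).toSSetObjEquiv (.op ⦋2⦌)).symm_apply_apply τ⟩
  have h0 : ∀ i j, edgePoint i j 0 = stdSimplex.vertex i := by
    intro i j
    refine Subtype.ext (funext fun k => ?_)
    rw [edgePoint_apply]
    simp [Pi.single_apply, eq_comm]
  have h1 : ∀ i j, edgePoint i j 1 = stdSimplex.vertex j := by
    intro i j
    refine Subtype.ext (funext fun k => ?_)
    rw [edgePoint_apply]
    simp [Pi.single_apply, eq_comm]
  let e : ∀ i j : Fin 3, Path (stdSimplex.vertex i : stdSimplex ℝ (Fin 3)) (stdSimplex.vertex j) :=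
    fun i j => ⟨⟨edgePoint i j, continuous_edgePoint i j⟩, h0 i j, h1 i j⟩
  have : ContractibleSpace (stdSimplex ℝ (Fin 3)) :=
    (convex_stdSimplex ℝ (Fin 3)).contractibleSpace ⟨_, (stdSimplex.vertex 0).2⟩
  have h : Path.Homotopic.Quotient.mk ((e 0 1).trans (e 1 2)) =
    Path.Homotopic.Quotient.mk (e 0 2) := Subsingleton.elim _ _
  have h' := congrArg (fun γ => Path.Homotopic.Quotient.map γ F) h
  simp only [Path.Homotopic.Quotient.mk_trans, quotient_map_trans] at h'
  refine ⟨_, _, _, (e 0 1).map F.continuous, (e 1 2).map F.continuous, (e 0 2).map F.continuous,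
    δ_triangleSimplex F 2 _ fun t => rfl, δ_triangleSimplex F 0 _ fun t => rfl,
    δ_triangleSimplex F 1 _ fun t => rfl, h'⟩

/-- Since `homologyι` is a monomorphism, identities between loop classes can be checked on 1-chains
modulo boundaries, where paths that are not closed also have classes. -/
theorem loopClass_homologyι (G : Type u) [AddCommGroup G] {y : X} (p : Path y y) :
    loopClass G p ≫ HomologicalComplex.homologyι _ 1 =
      edgeClass (AddCommGrpCat.of G) (pathSimplex p).edge := by
  rw [loopClass, Category.assoc, HomologicalComplex.homology_π_ι,
    HomologicalComplex.liftCycles_i_assoc]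
  rfl

end singular

end RipsCech

/-! ### The Hurewicz map modulo short loops, and cocycles valued in homomorphism groups. -/

namespace RipsCech

open unitInterval Topology Simplicial

/-! ### Classes of loops in singular homology -/

section hurewicz

variable {X : Type u} [TopologicalSpace X] (G : Type u) [AddCommGroup G]

/-- The inclusion of the first homology in the 1-chains modulo boundaries. -/
noncomputable abbrev hι (S : SSet.{u}) (A : AddCommGrpCat.{u}) :
    S.homology A 1 ⟶ (S.chainComplex A).opcycles 1 :=
  HomologicalComplex.homologyι _ 1

/-- The homology class of a homotopy class of loops. -/
noncomputable def hurewicz {y : X} (γ : Path.Homotopic.Quotient y y) :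
    AddCommGrpCat.of G ⟶ singularHOne X G :=
  Quotient.lift (fun p => loopClass G p) (fun p q h => by
    rw [← cancel_mono (hι _ _)]
    exact (loopClass_homologyι G p).trans
      ((edgeClass_eq_of_homotopic h).trans (loopClass_homologyι G q).symm)) γ

theorem hurewicz_mk {y : X} (p : Path y y) :
    hurewicz G (Path.Homotopic.Quotient.mk p) = loopClass G p :=
  rfl

theorem hurewicz_ι {y : X} (γ : Path.Homotopic.Quotient y y) :
    hurewicz G γ ≫ hι _ _ = quotClass (AddCommGrpCat.of G) γ := by
  rcases γ with ⟨p⟩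
  exact loopClass_homologyι G p

/-- The tail contributes its class once with each sign, so homology sees only the loop of a lasso.
-/
theorem hurewicz_conj {x y : X} (α : Path.Homotopic.Quotient x y)
    (β : Path.Homotopic.Quotient y y) :
    hurewicz G ((α.trans β).trans α.symm) = hurewicz G β := by
  rw [← cancel_mono (hι _ _), hurewicz_ι, hurewicz_ι, quotClass_trans, quotClass_trans,
    quotClass_symm]
  abel

/-- The Hurewicz homomorphism. -/
noncomputable def hurewiczHom (x : X) :
    FundamentalGroup X x →* Multiplicative (AddCommGrpCat.of G ⟶ singularHOne X G) where
  toFun c := Multiplicative.ofAdd (hurewicz G (FundamentalGroup.toPath c))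
  map_one' := by
    change Multiplicative.ofAdd (hurewicz G (Path.Homotopic.Quotient.refl x)) = 1
    rw [← ofAdd_zero]
    congr 1
    rw [← cancel_mono (hι _ _), hurewicz_ι, Limits.zero_comp]
    exact edgeClass_refl x
  map_mul' p q := by
    change Multiplicative.ofAdd (hurewicz G
      (Path.Homotopic.Quotient.trans (FundamentalGroup.toPath q) (FundamentalGroup.toPath p))) = _
    rw [← ofAdd_add]
    congr 1
    rw [← cancel_mono (hι _ _), hurewicz_ι, quotClass_trans, Preadditive.add_comp, hurewicz_ι,
      hurewicz_ι]

/-- Postcomposition with a morphism, as a homomorphism of multiplicative groups. -/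
def postcomp (A : AddCommGrpCat.{u}) {B C : AddCommGrpCat.{u}} (f : B ⟶ C) :
    Multiplicative (A ⟶ B) →* Multiplicative (A ⟶ C) :=
  AddMonoidHom.toMultiplicative (Preadditive.rightComp A f)

end hurewicz

section quotient

variable {X : Type u} [MetricSpace X] (G : Type u) [AddCommGroup G]

/-- The quotient of the classes of rectifiable loops by the classes of loops of length less
than `L`. -/
abbrev QuotH (X : Type u) [MetricSpace X] (G : Type u) [AddCommGroup G] (L : ℝ) : Type u :=
  finH X G ⧸ (shortH X G L).addSubgroupOf (finH X G)

theorem loopClass_mem_shortH {y : X} {β : Path y y} {L : ℝ}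
    (hβ : pathLength β < ENNReal.ofReal L) (g : G) : (loopClass G β).hom g ∈ shortH X G L :=
  AddSubgroup.subset_closure ⟨y, β, g, hβ, rfl⟩

theorem loopClass_mem_finH {y : X} {β : Path y y} (hβ : pathLength β ≠ ⊤) (g : G) :
    (loopClass G β).hom g ∈ finH X G := by
  obtain ⟨n, hn⟩ := ENNReal.exists_nat_gt hβ
  exact AddSubgroup.mem_iSup_of_mem n (loopClass_mem_shortH G (by rwa [ENNReal.ofReal_natCast]) g)

theorem hurewicz_mem_finH {y : X} {γ : Path.Homotopic.Quotient y y} (hγ : Rect γ) (g : G) :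
    (hurewicz G γ).hom g ∈ finH X G := by
  obtain ⟨p, hp, rfl⟩ := hγ
  exact loopClass_mem_finH G hp g

/-- Lassos go to the classes of their loops. Composing with the quotient map `q` turns membership
into the kernel of a homomorphism, which reduces the claim to generators. -/
theorem hurewicz_mem_shortH {x₀ : X} {L : ℝ} {c : FundamentalGroup X x₀}
    (hc : c ∈ shortPi X x₀ L) (g : G) :
    (hurewicz G (FundamentalGroup.toPath c)).hom g ∈ shortH X G L := by
  let q : singularHOne X G ⟶ AddCommGrpCat.of (singularHOne X G ⧸ shortH X G L) :=
    AddCommGrpCat.ofHom (QuotientAddGroup.mk' (shortH X G L))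
  have h : shortPi X x₀ L ≤ ((postcomp (AddCommGrpCat.of G) q).comp (hurewiczHom G x₀)).ker := by
    refine (Subgroup.closure_le _).2 ?_
    rintro _ ⟨y, α, β, -, hβ, rfl⟩
    change hurewicz G (Path.Homotopic.Quotient.mk ((α.trans β).trans α.symm)) ≫ q = 0
    rw [Path.Homotopic.Quotient.mk_trans, Path.Homotopic.Quotient.mk_trans,
      Path.Homotopic.Quotient.mk_symm, hurewicz_conj]
    ext g
    exact (QuotientAddGroup.eq_zero_iff _).2 (loopClass_mem_shortH G hβ g)
  have h' : hurewicz G (FundamentalGroup.toPath c) ≫ q = 0 := h hc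
  exact (QuotientAddGroup.eq_zero_iff _).1 (ConcreteCategory.congr_hom h' g)

/-- The class modulo short loops of a rectifiable loop. -/
noncomputable def hurewiczMod (L : ℝ) {y : X} (γ : Path.Homotopic.Quotient y y) (hγ : Rect γ) :
    AddCommGrpCat.of G ⟶ AddCommGrpCat.of (QuotH X G L) :=
  AddCommGrpCat.ofHom ((QuotientAddGroup.mk' _).comp
    ((hurewicz G γ).hom.codRestrict (finH X G) (hurewicz_mem_finH G hγ)))

theorem hurewiczMod_congr (L : ℝ) {y z : X} {γ : Path.Homotopic.Quotient y y}
    {δ : Path.Homotopic.Quotient z z} (hγ : Rect γ) (hδ : Rect δ)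
    (h : hurewicz G γ = hurewicz G δ) : hurewiczMod G L γ hγ = hurewiczMod G L δ hδ := by
  ext g
  exact congrArg QuotientAddGroup.mk (Subtype.ext (ConcreteCategory.congr_hom h g))

/-- The Hurewicz homomorphism modulo short loops. -/
noncomputable def hurewiczQuot (x₀ : X) (L : ℝ) : QuotPi X x₀ L →*
    Multiplicative (AddCommGrpCat.of G ⟶ AddCommGrpCat.of (QuotH X G L)) :=
  QuotientGroup.lift _
    { toFun := fun c => Multiplicative.ofAdd
        (hurewiczMod G L (FundamentalGroup.toPath c.1) (rect_of_mem_finPi x₀ c.2))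
      map_one' := by
        rw [← ofAdd_zero]
        congr 1
        ext g
        exact congrArg QuotientAddGroup.mk (Subtype.ext
          (ConcreteCategory.congr_hom (congrArg Multiplicative.toAdd (hurewiczHom G x₀).map_one) g))
      map_mul' := fun c d => by
        rw [← ofAdd_add]
        congr 1
        ext g
        exact congrArg QuotientAddGroup.mk (Subtype.ext
          (ConcreteCategory.congr_hom
            (congrArg Multiplicative.toAdd ((hurewiczHom G x₀).map_mul c.1 d.1)) g)) }
    (fun c hc => by
      change hurewiczMod G L (FundamentalGroup.toPath c.1) (rect_of_mem_finPi x₀ c.2) = 0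
      ext g
      exact (QuotientAddGroup.eq_zero_iff _).2 (hurewicz_mem_shortH G hc g))

theorem hurewiczQuot_pathClass (hX : IsGeodesicSpace X) (x₀ : X) (L : ℝ) {y z : X}
    {γ : Path.Homotopic.Quotient y z} (hγ : Rect γ) :
    hurewiczQuot G x₀ L (pathClass hX x₀ L γ) = Multiplicative.ofAdd
      (hurewiczMod G L (FundamentalGroup.toPath (loopAt hX x₀ γ))
        (rect_of_mem_finPi x₀ (loopAt_mem_finPi hX x₀ hγ))) := by
  rw [pathClass_of_rect hX x₀ L hγ]
  rfl

end quotient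

/-! ### Ordered 1-simplices of a complex -/

section ordered

variable {V : Type u} {K : AbstractSimplicialComplex V} {G A : AddCommGrpCat.{u}}

/-- A vertex as an ordered simplex. -/
def orderedVertex (K : AbstractSimplicialComplex V) (v : V) : (orderedSimplices.obj K) _⦋0⦌ :=
  ⟨fun _ => v, {v}, K.singleton_mem v, fun _ => by simp⟩

/-- An edge as an ordered simplex. -/
def orderedEdge {v w : V} (h : Spans K v w w) : (orderedSimplices.obj K) _⦋1⦌ :=
  ⟨![v, w], h.imp fun s hs => ⟨hs.1, fun i => by
    fin_cases i
    exacts [hs.2.1, hs.2.2.1]⟩⟩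

/-- A triangle as an ordered simplex. -/
def orderedTriangle {u v w : V} (h : Spans K u v w) : (orderedSimplices.obj K) _⦋2⦌ :=
  ⟨![u, v, w], h.imp fun s hs => ⟨hs.1, fun i => by
    fin_cases i
    exacts [hs.2.1, hs.2.2.1, hs.2.2.2]⟩⟩

theorem spans_of_edge (x : (orderedSimplices.obj K) _⦋1⦌) :
    Spans K (x.1 0) (x.1 1) (x.1 1) :=
  x.2.imp fun _ hs => ⟨hs.1, hs.2 0, hs.2 1, hs.2 1⟩

theorem orderedEdge_spans_of_edge (x : (orderedSimplices.obj K) _⦋1⦌) :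
    orderedEdge (spans_of_edge x) = x := by
  refine Subtype.ext (funext fun i => ?_)
  fin_cases i <;> rfl

theorem δ_zero_edge (x : (orderedSimplices.obj K) _⦋1⦌) :
    (orderedSimplices.obj K).δ 0 x = orderedVertex K (x.1 1) := by
  refine Subtype.ext (funext fun i => ?_)
  fin_cases i
  rfl

theorem δ_one_edge (x : (orderedSimplices.obj K) _⦋1⦌) :
    (orderedSimplices.obj K).δ 1 x = orderedVertex K (x.1 0) := by
  refine Subtype.ext (funext fun i => ?_)
  fin_cases i
  rfl

/-- The homomorphism on chains modulo boundaries defined by a cocycle. -/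
theorem exists_cocycleDesc {e : V → V → Multiplicative (G ⟶ A)} (he : IsCocycle K e) :
    ∃ F : ((orderedSimplices.obj K).chainComplex G).opcycles 1 ⟶ A,
      ∀ x, edgeClass G x ≫ F = (e (x.1 0) (x.1 1)).toAdd := by
  refine exists_descEdge (S := orderedSimplices.obj K) (fun x => (e (x.1 0) (x.1 1)).toAdd) fun τ => ?_
  exact (congrArg Multiplicative.toAdd (he (τ.1 0) (τ.1 1) (τ.1 2)
    (τ.2.imp fun _ hs => ⟨hs.1, hs.2 0, hs.2 1, hs.2 2⟩))).symm

/-- The homomorphism on chains modulo boundaries defined by a cocycle. -/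
noncomputable def cocycleDesc {e : V → V → Multiplicative (G ⟶ A)} (he : IsCocycle K e) :
    ((orderedSimplices.obj K).chainComplex G).opcycles 1 ⟶ A :=
  (exists_cocycleDesc he).choose

theorem edgeClass_cocycleDesc {e : V → V → Multiplicative (G ⟶ A)} (he : IsCocycle K e)
    (x : (orderedSimplices.obj K) _⦋1⦌) :
    edgeClass G x ≫ cocycleDesc he = (e (x.1 0) (x.1 1)).toAdd :=
  (exists_cocycleDesc he).choose_spec x

open Classical in
/-- The universal cocycle: the class of an edge in the chains modulo boundaries. -/
noncomputable def edgeCocycle (K : AbstractSimplicialComplex V) (G : AddCommGrpCat.{u})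
    (v w : V) : Multiplicative (G ⟶ ((orderedSimplices.obj K).chainComplex G).opcycles 1) :=
  if h : Spans K v w w then Multiplicative.ofAdd (edgeClass G (orderedEdge h)) else 1

theorem edgeCocycle_of_spans {v w : V} (h : Spans K v w w) :
    edgeCocycle K G v w = Multiplicative.ofAdd (edgeClass G (orderedEdge h)) :=
  dif_pos h

theorem edgeCocycle_edge (x : (orderedSimplices.obj K) _⦋1⦌) :
    edgeCocycle K G (x.1 0) (x.1 1) = Multiplicative.ofAdd (edgeClass G x) := by
  rw [edgeCocycle_of_spans (spans_of_edge x), orderedEdge_spans_of_edge]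

theorem isCocycle_edgeCocycle : IsCocycle K (edgeCocycle K G) := by
  intro u v w h
  have h1 := edgeCocycle_edge (G := G) ((orderedSimplices.obj K).δ 0 (orderedTriangle h))
  have h2 := edgeCocycle_edge (G := G) ((orderedSimplices.obj K).δ 1 (orderedTriangle h))
  have h3 := edgeCocycle_edge (G := G) ((orderedSimplices.obj K).δ 2 (orderedTriangle h))
  rw [edgeClass_δ, ofAdd_add, ← h1, ← h3] at h2
  exact h2.symm

/-- A morphism out of the 0-chains, prescribed on vertices. -/
theorem exists_descVertex (f : V → (G ⟶ A)) :
    ∃ D : ((orderedSimplices.obj K).chainComplex G).X 0 ⟶ A,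
      ∀ v, (orderedSimplices.obj K).ιChainComplex (orderedVertex K v) ≫ D = f v :=
  ⟨Limits.Cofan.IsColimit.desc ((orderedSimplices.obj K).isColimitChainComplexXCofan G 0)
      (fun x => f (x.1 0)),
    fun v => Limits.Cofan.IsColimit.fac
      ((orderedSimplices.obj K).isColimitChainComplexXCofan G 0) _ (orderedVertex K v)⟩

theorem ordered_edgeClass_fromOpcycles (x : (orderedSimplices.obj K) _⦋1⦌) :
    edgeClass G x ≫ ((orderedSimplices.obj K).chainComplex G).fromOpcycles 1 0 =
      (orderedSimplices.obj K).ιChainComplex (orderedVertex K (x.1 1)) -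
        (orderedSimplices.obj K).ιChainComplex (orderedVertex K (x.1 0)) := by
  rw [edgeClass_fromOpcycles, δ_zero_edge, δ_one_edge]

end ordered

end RipsCech

/-! ### The comparison isomorphism on first homology. -/

namespace RipsCech

open unitInterval Topology Simplicial

/-! ### The first homology of a tight complex -/

section

variable {X : Type u} [MetricSpace X] {K : AbstractSimplicialComplex X} {L ρ : ℝ}

/-- The trivial homomorphism carries such a cocycle to itself with trivial gauge, and therefore also
its holonomy. -/
theorem CoverCocycle.hol_one {V Y H : Type*} [TopologicalSpace Y] [Group H]
    (c : CoverCocycle V Y H) (he : ∀ v w, c.e v w = 1) {y z : Y}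
    (γ : Path.Homotopic.Quotient y z) {v w : V} (hy : y ∈ c.U v) (hz : z ∈ c.U w) :
    c.hol v w γ = 1 := by
  simpa using (c.hol_gauge c (1 : H →* H) 1 (fun _ _ h => h) (fun v w _ _ _ => by simp [he])
    γ hy hz).symm

/-- Holonomy with values in an abelian group is defined on singular chains modulo boundaries. -/
theorem exists_holDesc {G A : AddCommGrpCat.{u}} (hK : IsTight K L ρ)
    {e : X → X → Multiplicative (G ⟶ A)} (he : IsCocycle K e) :
    ∃ T : ((TopCat.toSSet.obj (TopCat.of X)).chainComplex G).opcycles 1 ⟶ A,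
      ∀ {y z : X} (γ : Path.Homotopic.Quotient y z),
        quotClass G γ ≫ T = ((hK.ballCocycle he).hol y z γ).toAdd := by
  -- The path read off from a singular simplex has the right ends only up to propositional equality.
  have key : ∀ {y z : X} (p : Path y z),
      (hK.ballCocycle he).hol _ _
        (Path.Homotopic.Quotient.mk (simplexPath (pathSimplex p).edge)) =
      (hK.ballCocycle he).hol y z (Path.Homotopic.Quotient.mk p) := fun {y z} p =>
    simplexPath_pathSimplex p (fun {y' z'} γ => (hK.ballCocycle he).hol y' z' γ =
      (hK.ballCocycle he).hol y z (Path.Homotopic.Quotient.mk p)) rfl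
  obtain ⟨T, hT⟩ := exists_descEdge (S := TopCat.toSSet.obj (TopCat.of X)) (G := G)
    (fun s => ((hK.ballCocycle he).hol (simplexMap s 0) (simplexMap s 1)
      (Path.Homotopic.Quotient.mk (simplexPath s))).toAdd) fun τ => by
    obtain ⟨a, b, c, p, q, r, h2, h0, h1, h⟩ := exists_triangle_paths τ
    rw [h0, h1, h2, key, key, key, ← h,
      (hK.ballCocycle he).hol_trans _ b _ _ _ (Metric.mem_ball_self hK.pos), toAdd_mul]
  refine ⟨T, fun {y z} γ => ?_⟩
  rcases γ with ⟨p⟩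
  exact (hT _).trans (congrArg Multiplicative.toAdd (key p))

/-- Closing up a path with geodesics to `x₀` adds a difference of terms depending only on the ends;
such terms disappear on cycles. -/
theorem quotClass_loopAt {G : AddCommGrpCat.{u}} (hX : IsGeodesicSpace X) (x₀ : X) {y z : X}
    (γ : Path.Homotopic.Quotient y z) :
    quotClass G (FundamentalGroup.toPath (loopAt hX x₀ γ)) =
      quotClass G γ + quotClass G (Path.Homotopic.Quotient.mk (geod hX x₀ y)) -
        quotClass G (Path.Homotopic.Quotient.mk (geod hX x₀ z)) := by
  change quotClass G ((Path.Homotopic.Quotient.trans _ _).trans _) = _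
  rw [quotClass_trans, quotClass_trans, quotClass_symm]
  abel

variable (G : Type u) [AddCommGroup G] (hX : IsGeodesicSpace X) (x₀ : X)

theorem isCocycle_hurewiczQuot (hK : IsTight K L ρ) :
    IsCocycle K (fun v w => hurewiczQuot G x₀ L (geodClass hX x₀ L v w)) := fun u v w h => by
  rw [← map_mul, isCocycle_geodClass hX x₀ hK u v w h]

/-- The comparison homomorphism from the first homology of a tight complex. -/
noncomputable def homologyHol (hK : IsTight K L ρ) :
    (orderedSimplices.obj K).homology (AddCommGrpCat.of G) 1 ⟶ AddCommGrpCat.of (QuotH X G L) :=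
  hι _ _ ≫ cocycleDesc (isCocycle_hurewiczQuot G hX x₀ hK)

/-- Holonomy of the universal edge cocycle kills short loops, hence induces `φ` from the quotient to
the chains modulo boundaries. The composite of `homologyHol` with `φ` is the inclusion of homology,
a monomorphism. -/
theorem homologyHol_mono (hK : IsTight K L ρ) : Mono (homologyHol G hX x₀ hK) := by
  have he := isCocycle_edgeCocycle (K := K) (G := AddCommGrpCat.of G)
  have hball : ∀ y : X, y ∈ Metric.ball y ρ := fun y => Metric.mem_ball_self hK.pos
  obtain ⟨T, hT⟩ := exists_holDesc hK he
  let t : singularHOne X G ⟶ _ := hι _ _ ≫ T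
  have ht : shortH X G L ≤ t.hom.ker := by
    refine (AddSubgroup.closure_le _).2 ?_
    rintro _ ⟨y, β, g, hβ, rfl⟩
    have h : loopClass G β ≫ t = 0 := by
      rw [← hurewicz_mk, ← Category.assoc, hurewicz_ι, hT, hol_short_loop hK he β hβ, toAdd_one]
    exact ConcreteCategory.congr_hom h g
  let φ : AddCommGrpCat.of (QuotH X G L) ⟶
      ((orderedSimplices.obj K).chainComplex (AddCommGrpCat.of G)).opcycles 1 :=
    AddCommGrpCat.ofHom (QuotientAddGroup.lift _ (t.hom.comp (finH X G).subtype)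
      (fun c hc => ht hc))
  have hφ : ∀ {y : X} (γ : Path.Homotopic.Quotient y y) (hγ : Rect γ),
      hurewiczMod G L γ hγ ≫ φ = quotClass (AddCommGrpCat.of G) γ ≫ T := by
    intro y γ hγ
    rw [← hurewicz_ι, Category.assoc]
    rfl
  let a : X → (AddCommGrpCat.of G ⟶
      ((orderedSimplices.obj K).chainComplex (AddCommGrpCat.of G)).opcycles 1) :=
    fun v => quotClass (AddCommGrpCat.of G) (Path.Homotopic.Quotient.mk (geod hX x₀ v)) ≫ T
  obtain ⟨D, hD⟩ := exists_descVertex (K := K) a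
  -- On an edge, `φ` returns that edge together with the two terms from the geodesics to `x₀`; these
  -- make up the boundary followed by `D`.
  have key : cocycleDesc (isCocycle_hurewiczQuot G hX x₀ hK) ≫ φ =
      𝟙 _ - HomologicalComplex.fromOpcycles _ 1 0 ≫ D := by
    refine opcycles_hom_ext fun x => ?_
    have h1 := hol_geod hX hK he (spans_of_edge x)
    rw [← Category.assoc, edgeClass_cocycleDesc, geodClass,
      hurewiczQuot_pathClass G hX x₀ L (Rect.mk (pathLength_geod_ne_top hX _ _)), toAdd_ofAdd, hφ,
      quotClass_loopAt, Preadditive.sub_comp, Preadditive.add_comp, hT, h1, edgeCocycle_edge,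
      toAdd_ofAdd, Preadditive.comp_sub, Category.comp_id, ← Category.assoc,
      ordered_edgeClass_fromOpcycles, Preadditive.sub_comp, hD, hD]
    simp only [a]
    abel
  have h2 : homologyHol G hX x₀ hK ≫ φ = hι _ _ := by
    rw [homologyHol, Category.assoc, key, Preadditive.comp_sub, Category.comp_id,
      HomologicalComplex.homologyι_comp_fromOpcycles_assoc, Limits.zero_comp, sub_zero]
  have : Mono (homologyHol G hX x₀ hK ≫ φ) := by
    rw [h2]
    infer_instance
  exact mono_of_mono _ φ

/-- The lift is the holonomy of the universal edge cocycle along `β`: informally, the simplicial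
loop obtained by subdividing `β` finely. -/
theorem exists_lift_loop (hK : IsTight K L ρ) {y : X} (β : Path y y) (hβ : pathLength β ≠ ⊤) :
    ∃ l : AddCommGrpCat.of G ⟶ (orderedSimplices.obj K).homology (AddCommGrpCat.of G) 1,
      l ≫ homologyHol G hX x₀ hK = hurewiczMod G L (Path.Homotopic.Quotient.mk β) (Rect.mk hβ) := by
  have he := isCocycle_edgeCocycle (K := K) (G := AddCommGrpCat.of G)
  have hball : ∀ y : X, y ∈ Metric.ball y ρ := fun y => Metric.mem_ball_self hK.pos
  have hl := isCocycle_hurewiczQuot G hX x₀ hK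
  have hg := isCocycle_geodClass hX x₀ hK
  let C := (orderedSimplices.obj K).chainComplex (AddCommGrpCat.of G)
  let t : AddCommGrpCat.of G ⟶ C.opcycles 1 :=
    ((hK.ballCocycle he).hol y y (Path.Homotopic.Quotient.mk β)).toAdd
  -- The boundary of an edge is the difference of its ends. It is thus the trivial cocycle in the
  -- gauge sending a vertex to its 0-chain, and the holonomy of a closed path has no boundary.
  have ht : t ≫ C.fromOpcycles 1 0 = 0 := by
    have h1 : IsCocycle K fun _ _ : X => (1 : Multiplicative (AddCommGrpCat.of G ⟶ C.X 0)) :=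
      fun _ _ _ _ => one_mul 1
    have h := CoverCocycle.hol_gauge (hK.ballCocycle he) (hK.ballCocycle h1)
      (postcomp (AddCommGrpCat.of G) (C.fromOpcycles 1 0))
      (fun v => Multiplicative.ofAdd
        ((orderedSimplices.obj K).ιChainComplex (orderedVertex K v)))
      (fun v y hy => hy) (fun v w y hv hw => by
        have hs := hK.nerve v w w y hv hw hw
        change postcomp _ _ (edgeCocycle K _ v w) = _
        rw [edgeCocycle_of_spans hs]
        change Multiplicative.ofAdd (edgeClass _ (orderedEdge hs) ≫ C.fromOpcycles 1 0) = _
        rw [ordered_edgeClass_fromOpcycles]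
        simp only [IsTight.ballCocycle_e, mul_one, ← div_eq_mul_inv]
        rfl)
      (Path.Homotopic.Quotient.mk β) (hball y) (hball y)
    rw [(hK.ballCocycle h1).hol_one (fun _ _ => rfl) _ (hball y) (hball y), mul_one,
      mul_inv_cancel] at h
    exact h
  -- The edge cocycle and the geodesic cocycle both map to `hl`, so their holonomies along `β` have
  -- equal images; the second is known from `hol_geodClass`.
  have hd : t ≫ cocycleDesc hl =
      hurewiczMod G L (Path.Homotopic.Quotient.mk β) (Rect.mk hβ) := by
    have h1 := CoverCocycle.hol_gauge (hK.ballCocycle he) (hK.ballCocycle hl)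
      (postcomp (AddCommGrpCat.of G) (cocycleDesc hl)) 1 (fun v y hy => hy)
      (fun v w y hv hw => by
        have hs := hK.nerve v w w y hv hw hw
        change postcomp _ _ (edgeCocycle K _ v w) = _
        rw [edgeCocycle_of_spans hs]
        change Multiplicative.ofAdd (edgeClass _ (orderedEdge hs) ≫ cocycleDesc hl) = _
        rw [edgeClass_cocycleDesc, Pi.one_apply, Pi.one_apply, one_mul, inv_one, mul_one]
        rfl)
      (Path.Homotopic.Quotient.mk β) (hball y) (hball y)
    have h2 := CoverCocycle.hol_gauge (hK.ballCocycle hg) (hK.ballCocycle hl)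
      (hurewiczQuot G x₀ L) 1 (fun v y hy => hy)
      (fun v w y hv hw => by
        rw [Pi.one_apply, Pi.one_apply, one_mul, inv_one, mul_one]
        rfl)
      (Path.Homotopic.Quotient.mk β) (hball y) (hball y)
    rw [Pi.one_apply, one_mul, inv_one, mul_one] at h1 h2
    rw [← h2, hol_geodClass hX x₀ hK β hβ,
      hurewiczQuot_pathClass G hX x₀ L (Rect.mk hβ)] at h1
    refine (congrArg Multiplicative.toAdd h1).trans (hurewiczMod_congr G L
      (rect_of_mem_finPi x₀ (loopAt_mem_finPi hX x₀ (Rect.mk hβ))) (Rect.mk hβ) ?_)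
    exact hurewicz_conj G _ _
  -- Homology is the kernel of the boundary on chains modulo boundaries, so `t` lifts.
  let hker := C.homologyIsKernel 1 0 (ChainComplex.next_nat_succ 0)
  refine ⟨Limits.KernelFork.IsLimit.lift' hker t ht |>.1, ?_⟩
  have h := (Limits.KernelFork.IsLimit.lift' hker t ht).2
  rw [homologyHol, ← Category.assoc, ← hd]
  exact congrArg (· ≫ cocycleDesc hl) h

theorem homologyHol_surjective (hK : IsTight K L ρ) :
    Function.Surjective (homologyHol G hX x₀ hK).hom := by
  -- `finH` is generated inside `H₁(X; G)`, so the range is pulled back to `finH` and pushed forward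
  -- there; only the generators then have to be hit.
  have h : finH X G ≤ (AddSubgroup.comap (QuotientAddGroup.mk' _)
      (homologyHol G hX x₀ hK).hom.range).map (finH X G).subtype := by
    refine iSup_le fun n => (AddSubgroup.closure_le _).2 ?_
    rintro _ ⟨y, β, g, hβ, rfl⟩
    obtain ⟨l, hl⟩ := exists_lift_loop G hX x₀ hK β hβ.ne_top
    exact ⟨⟨_, loopClass_mem_finH G hβ.ne_top g⟩, ⟨l.hom g, ConcreteCategory.congr_hom hl g⟩, rfl⟩
  intro c
  obtain ⟨⟨c, hc⟩, rfl⟩ := QuotientAddGroup.mk_surjective c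
  obtain ⟨⟨d, hd⟩, h', rfl⟩ := h hc
  exact h'

theorem homologyHol_isIso (hK : IsTight K L ρ) : IsIso (homologyHol G hX x₀ hK) := by
  have := homologyHol_mono G hX x₀ hK
  have : Epi (homologyHol G hX x₀ hK) :=
    (AddCommGrpCat.epi_iff_surjective _).2 (homologyHol_surjective G hX x₀ hK)
  exact isIso_of_mono_of_epi _

/-- It suffices to evaluate on edges, where both sides give the class of the same geodesic closed up
at `x₀`. -/
theorem homologyHol_naturality {K' : AbstractSimplicialComplex X} {L' ρ' : ℝ}
    (hK : IsTight K L ρ) (hK' : IsTight K' L' ρ') (f : K ⟶ K') (hL : L ≤ L') :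
    (hOne X G).map f ≫ homologyHol G hX x₀ hK' = homologyHol G hX x₀ hK ≫
      AddCommGrpCat.ofHom (QuotientAddGroup.map ((shortH X G L).addSubgroupOf (finH X G))
        ((shortH X G L').addSubgroupOf (finH X G)) (AddMonoidHom.id (finH X G))
        (fun _ h => shortH_mono X G hL h)) := by
  have h : HomologicalComplex.opcyclesMap
      (SSet.chainComplexMap (orderedSimplices.map f) (AddCommGrpCat.of G)) 1 ≫
        cocycleDesc (isCocycle_hurewiczQuot G hX x₀ hK') =
      cocycleDesc (isCocycle_hurewiczQuot G hX x₀ hK) ≫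
        AddCommGrpCat.ofHom (QuotientAddGroup.map ((shortH X G L).addSubgroupOf (finH X G))
        ((shortH X G L').addSubgroupOf (finH X G)) (AddMonoidHom.id (finH X G))
          (fun _ h => shortH_mono X G hL h)) := by
    refine opcycles_hom_ext fun x => ?_
    have h1 : edgeClass (AddCommGrpCat.of G) x ≫ HomologicalComplex.opcyclesMap
        (SSet.chainComplexMap (orderedSimplices.map f) (AddCommGrpCat.of G)) 1 =
        edgeClass (AddCommGrpCat.of G) ((orderedSimplices.map f).app _ x) := by
      rw [edgeClass, Category.assoc, HomologicalComplex.p_opcyclesMap,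
        SSet.ι_chainComplexMap_f_assoc, edgeClass]
    have hr : ∀ v w, Rect (Path.Homotopic.Quotient.mk (geod hX v w)) := fun v w =>
      Rect.mk (pathLength_geod_ne_top hX v w)
    rw [← Category.assoc, h1, ← Category.assoc, edgeClass_cocycleDesc, edgeClass_cocycleDesc,
      geodClass, geodClass, hurewiczQuot_pathClass G hX x₀ L (hr _ _),
      hurewiczQuot_pathClass G hX x₀ L' (hr _ _)]
    rfl
  change HomologicalComplex.homologyMap _ 1 ≫ hι _ _ ≫ _ = _
  rw [HomologicalComplex.homologyι_naturality_assoc, h, homologyHol, Category.assoc]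

end

/-- An empty space has no base point for `homologyHol`; there both persistences vanish, as there are
no 1-simplices and no loops. -/
theorem isZero_hOne {X : Type u} [IsEmpty X] (G : Type u) [AddCommGroup G]
    (K : AbstractSimplicialComplex X) :
    Limits.IsZero ((hOne X G).obj K) := by
  have h : Limits.IsZero
      (((orderedSimplices.obj K).chainComplex (AddCommGrpCat.of G)).opcycles 1) :=
    (Limits.IsZero.iff_id_eq_zero _).2 (opcycles_hom_ext fun x => isEmptyElim (x.1 0))
  have h' : Limits.IsZero ((orderedSimplices.obj K).homology (AddCommGrpCat.of G) 1) :=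
    h.of_mono (hι _ _)
  exact h'

section

variable {X : Type u} [MetricSpace X] (G : Type u) [AddCommGroup G]

theorem isZero_quotientH [IsEmpty X] (r : Scale) : Limits.IsZero ((quotientH X G).obj r) := by
  have h : finH X G = ⊥ := by
    refine le_bot_iff.1 (iSup_le fun n => (AddSubgroup.closure_le _).2 ?_)
    rintro _ ⟨y, -⟩
    exact isEmptyElim y
  have : Subsingleton (finH X G) := by
    rw [h]
    infer_instance
  have : Subsingleton ((quotientH X G).obj r) := QuotientAddGroup.mk_surjective.subsingleton
  exact AddCommGrpCat.isZero_of_subsingleton _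

/-- The natural isomorphism for a family of tight complexes. -/
theorem nonempty_hIso (hX : IsGeodesicSpace X) (F : Scale ⥤ AbstractSimplicialComplex X)
    (a : Scale ⥤ Scale) (ρ : Scale → ℝ) (hF : ∀ r, IsTight (F.obj r) (a.obj r).1 (ρ r)) :
    Nonempty (F ⋙ hOne X G ≅ a ⋙ quotientH X G) := by
  rcases isEmpty_or_nonempty X with h | ⟨⟨x₀⟩⟩
  · exact ⟨NatIso.ofComponents
      (fun r => (isZero_hOne G (F.obj r)).iso (isZero_quotientH G (a.obj r)))
      (fun _ => (isZero_hOne G _).eq_of_src _ _)⟩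
  · refine ⟨NatIso.ofComponents (fun r => ?_) fun {r s} f => ?_⟩
    · exact @asIso _ _ _ _ (homologyHol G hX x₀ (hF r)) (homologyHol_isIso G hX x₀ (hF r))
    · exact homologyHol_naturality G hX x₀ (hF r) (hF s) (F.map f) (a.map f).le

theorem isTight_scale_cech (X : Type u) [MetricSpace X] (r : Scale) :
    IsTight ((scaleBy 3 three_pos ⋙ cechFiltration X).obj r)
      ((scaleBy 12 (by norm_num)).obj r).1 (3 * r.1) := by
  have h := isTight_cech (X := X) ((scaleBy 3 three_pos).obj r)
  have e : 4 * ((scaleBy 3 three_pos).obj r).1 = 12 * r.1 := by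
    change 4 * (3 * r.1) = 12 * r.1
    ring
  rw [e] at h
  exact h

theorem isTight_scale_rips (X : Type u) [MetricSpace X] (r : Scale) :
    IsTight ((scaleBy 4 four_pos ⋙ ripsFiltration X).obj r)
      ((scaleBy 12 (by norm_num)).obj r).1 (4 * r.1 / 2) := by
  have h := isTight_rips (X := X) ((scaleBy 4 four_pos).obj r)
  have e : 3 * ((scaleBy 4 four_pos).obj r).1 = 12 * r.1 := by
    change 3 * (4 * r.1) = 12 * r.1
    ring
  rw [e] at h
  exact h

end

end RipsCech

theorem mainTheorem9 {X : Type u} [MetricSpace X] (hX : IsGeodesicSpace X) :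
    (∀ x₀ : X,
      Nonempty (scaleBy 3 three_pos ⋙ cechFiltration X ⋙ piOne x₀ ≅
        scaleBy 4 four_pos ⋙ ripsFiltration X ⋙ piOne x₀) ∧
      Nonempty (scaleBy 3 three_pos ⋙ cechFiltration X ⋙ piOne x₀ ≅
        scaleBy 12 (by norm_num) ⋙ quotientPi X x₀) ∧
      Nonempty (scaleBy 4 four_pos ⋙ ripsFiltration X ⋙ piOne x₀ ≅
        scaleBy 12 (by norm_num) ⋙ quotientPi X x₀)) ∧
    (∀ (G : Type u) [AddCommGroup G],
      Nonempty (scaleBy 3 three_pos ⋙ cechFiltration X ⋙ hOne X G ≅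
        scaleBy 4 four_pos ⋙ ripsFiltration X ⋙ hOne X G) ∧
      Nonempty (scaleBy 3 three_pos ⋙ cechFiltration X ⋙ hOne X G ≅
        scaleBy 12 (by norm_num) ⋙ quotientH X G) ∧
      Nonempty (scaleBy 4 four_pos ⋙ ripsFiltration X ⋙ hOne X G ≅
        scaleBy 12 (by norm_num) ⋙ quotientH X G)) := by
  refine ⟨fun x₀ => ?_, fun G _ => ?_⟩
  · have i := piIso hX x₀ (scaleBy 3 three_pos ⋙ cechFiltration X) (scaleBy 12 (by norm_num)) _
      (isTight_scale_cech X)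
    have j := piIso hX x₀ (scaleBy 4 four_pos ⋙ ripsFiltration X) (scaleBy 12 (by norm_num)) _
      (isTight_scale_rips X)
    -- Both complexes have threshold `12 * r`, as `4 * (3 * r) = 3 * (4 * r)`, so they are compared
    -- through the same quotient.
    exact ⟨⟨i ≪≫ j.symm⟩, ⟨i⟩, ⟨j⟩⟩
  · obtain ⟨i⟩ := nonempty_hIso G hX (scaleBy 3 three_pos ⋙ cechFiltration X)
      (scaleBy 12 (by norm_num)) _ (isTight_scale_cech X)
    obtain ⟨j⟩ := nonempty_hIso G hX (scaleBy 4 four_pos ⋙ ripsFiltration X)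
      (scaleBy 12 (by norm_num)) _ (isTight_scale_rips X)
    exact ⟨⟨i ≪≫ j.symm⟩, ⟨i⟩, ⟨j⟩⟩
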